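/- **Definitions.** Let $F_0(n)=n+1$ and $F_{d+1}(n)=F_d^{\,n+1}(n)$ (the $(n+1)$-fold iterate of $F_d$ applied to $n$). Fix a countably infinite set of counters. A configuration maps each counter to a natural number, with finite support. A program is an increment, decrement or zero-test command on a counter, or is of the form $\mathbf{loop}\,M$ (iterate $M$ any finite number of times), $M_1;M_2$ or $M_1\ \mathbf{or}\ M_2$; a decrement command is executable only if the counter is positive, and a test command only if the counter is zero. The size of a program is the number of its commands and connectives. Write $\alpha\xrightarrow{M}\beta$ if some execution of $M$ leads from $\alpha$ to $\beta$. A checking program is a program $M;\mathbf{test}(c_1);\dots;\mathbf{test}(c_k)$, $k\ge 0$, where $M$ contains no test command. A $K$-preamplifier for a triple of distinct counters $(x,y,b)$ is a checking program $A$ such that * every configuration $\beta$ with $0\xrightarrow{A}\beta$ satisfies $\beta(y)\ge\beta(b)\beta(x)$ and $\beta(c)=0$ for all counters $c\notin\{x,y,b\}$, and moreover $\beta(b)=K$ if $\beta(y)=\beta(b)\beta(x)$; * for every $\ell\ge 1$ there is a configuration $\beta$ with $0\xrightarrow{A}\beta$, $\beta(y)=\beta(b)\beta(x)$ and $\beta(x)=\ell$.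 A counter used by $A$ is safe if it is none of $x,y,b$ and does not occur in a test command of $A$. **Statement.** There are an algorithm (on a unit-cost random access machine with addition and subtraction, writing the program in prefix notation), a constant $C$, and a triple of counters $(x,y,b)$ such that, for all integers $d\ge 1$ and $n\ge 0$, the algorithm on input $(d,n)$ halts and outputs a $K$-preamplifier for $(x,y,b)$ with $K=2^{F_{d+1}(n)}$ which uses exactly $2d+6$ counters, exactly $d$ of which are safe; and, whenever $n\ge 1$, both the running time of the algorithm and the size of its output are at most $C\cdot n\,d\,4^n$. -/

import Mathlib

/-! ### Fast growing functions -/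

/-- `F_0(n) = n + 1` and `F_{d+1}(n) = F_d^{n+1}(n)`. -/
def fastF : ℕ → ℕ → ℕ
  | 0, n => n + 1
  | d + 1, n => (fastF d)^[n + 1] n

/-! ### Counter programs -/

/-- Counters are named by natural numbers; a configuration has finite support. -/
abbrev Config := ℕ →₀ ℕ

/-- General counter programs: increment, decrement and zero-test commands, loops, series
compositions and non-deterministic choices. -/
inductive Program where
  | inc (c : ℕ)
  | dec (c : ℕ)
  | test (c : ℕ)
  | loop (M : Program)
  | seq (M₁ M₂ : Program)
  | or (M₁ M₂ : Program)

namespace Program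

/-- The relation `α --M--> β` on configurations. -/
def Run : Program → Config → Config → Prop
  | inc c => fun α β => (∀ z, z ≠ c → α z = β z) ∧ β c = α c + 1
  | dec c => fun α β => (∀ z, z ≠ c → α z = β z) ∧ β c + 1 = α c
  | test c => fun α β => (∀ z, z ≠ c → α z = β z) ∧ β c = 0 ∧ α c = 0
  | loop M => Relation.ReflTransGen (Run M)
  | seq M₁ M₂ => fun α β => ∃ ρ, Run M₁ α ρ ∧ Run M₂ ρ β
  | or M₁ M₂ => fun α β => Run M₁ α β ∨ Run M₂ α β

/-- The size of a program. -/
def size : Program → ℕ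
  | inc _ => 1
  | dec _ => 1
  | test _ => 1
  | loop M => 1 + M.size
  | seq M₁ M₂ => 1 + M₁.size + M₂.size
  | or M₁ M₂ => 1 + M₁.size + M₂.size

/-- The set of counters used by a program. -/
def counters : Program → Finset ℕ
  | inc c => {c}
  | dec c => {c}
  | test c => {c}
  | loop M => M.counters
  | seq M₁ M₂ => M₁.counters ∪ M₂.counters
  | or M₁ M₂ => M₁.counters ∪ M₂.counters

/-- The set of counters that occur in a test command of a program. -/
def tested : Program → Finset ℕ
  | inc _ => ∅
  | dec _ => ∅
  | test c => {c}
  | loop M => M.tested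
  | seq M₁ M₂ => M₁.tested ∪ M₂.tested
  | or M₁ M₂ => M₁.tested ∪ M₂.tested

/-- The number of counters used by a program. -/
def dimension (M : Program) : ℕ := M.counters.card

/-- No test command occurs in the program. -/
def TestFree : Program → Prop
  | inc _ => True
  | dec _ => True
  | test _ => False
  | loop M => M.TestFree
  | seq M₁ M₂ => M₁.TestFree ∧ M₂.TestFree
  | or M₁ M₂ => M₁.TestFree ∧ M₂.TestFree

/-- The program `test c; test c₁; …; test cₖ`. -/
def tests (c : ℕ) : List ℕ → Program
  | [] => test c
  | c' :: cs => seq (test c) (tests c' cs)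

/-- The program `M; test c₁, …, cₖ`; it is `M` itself if there is no counter to test. -/
def withTests (M : Program) : List ℕ → Program
  | [] => M
  | c :: cs => seq M (tests c cs)

/-- Checking programs: test-free programs followed by final tests. -/
def IsChecking (A : Program) : Prop :=
  ∃ (M : Program) (cs : List ℕ), M.TestFree ∧ A = withTests M cs

/-- `A` is a `K`-preamplifier for the triple of (pairwise distinct) counters `(x, y, b)`. -/
structure IsPreamplifier (K : ℕ) (A : Program) (x y b : ℕ) : Prop where
  x_ne_y : x ≠ y
  x_ne_b : x ≠ b
  y_ne_b : y ≠ b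
  checking : A.IsChecking
  sound : ∀ β : Config, A.Run 0 β →
    β b * β x ≤ β y ∧ (∀ c, c ≠ x → c ≠ y → c ≠ b → β c = 0) ∧
      (β y = β b * β x → β b = K)
  complete : ∀ l : ℕ, 1 ≤ l → ∃ β : Config, A.Run 0 β ∧ β y = β b * β x ∧ β x = l

/-- The safe counters of a preamplifier `A` for `(x, y, b)`: those used by `A`, distinct from
`x`, `y`, `b`, and not tested at the end of `A`. -/
def safe (A : Program) (x y b : ℕ) : Finset ℕ :=
  A.counters \ ({x, y, b} ∪ A.tested)

/-- Prefix notation of a program, as a word of numbers. -/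
def encode : Program → List ℕ
  | inc c => [0, c]
  | dec c => [1, c]
  | test c => [2, c]
  | loop M => 3 :: M.encode
  | seq M₁ M₂ => 4 :: (M₁.encode ++ M₂.encode)
  | or M₁ M₂ => 5 :: (M₁.encode ++ M₂.encode)

end Program

/-! ### Random access machines with unit cost -/

/-- Random access machine programs, with structured control flow. The memory consists of
registers indexed by natural numbers and holding natural numbers; the output is write-only. -/
inductive Ram where
  /-- `R[i] := k` -/
  | const (i k : ℕ)
  /-- `R[i] := R[j] + R[k]` -/
  | add (i j k : ℕ)
  /-- `R[i] := R[j] - R[k]` (truncated) -/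
  | sub (i j k : ℕ)
  /-- `R[i] := R[R[j]]` -/
  | load (i j : ℕ)
  /-- `R[R[i]] := R[j]` -/
  | store (i j : ℕ)
  /-- append `R[i]` to the output -/
  | write (i : ℕ)
  | seq (P Q : Ram)
  /-- if `R[i] ≠ 0` then `P` else `Q` -/
  | ite (i : ℕ) (P Q : Ram)
  /-- while `R[i] ≠ 0` do `P` -/
  | while (i : ℕ) (P : Ram)

namespace Ram

/-- Memory and output of a machine. -/
structure State where
  mem : ℕ → ℕ
  out : List ℕ

/-- Assign the value `v` to register `i`. -/
def State.set (σ : State) (i v : ℕ) : State :=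
  ⟨Function.update σ.mem i v, σ.out⟩

/-- `Exec P σ t τ`: started in state `σ`, the program `P` halts in state `τ` after exactly `t`
steps. Every basic instruction and every evaluation of a condition is one step. -/
inductive Exec : Ram → State → ℕ → State → Prop where
  | const (i k : ℕ) (σ : State) : Exec (.const i k) σ 1 (σ.set i k)
  | add (i j k : ℕ) (σ : State) : Exec (.add i j k) σ 1 (σ.set i (σ.mem j + σ.mem k))
  | sub (i j k : ℕ) (σ : State) : Exec (.sub i j k) σ 1 (σ.set i (σ.mem j - σ.mem k))
  | load (i j : ℕ) (σ : State) : Exec (.load i j) σ 1 (σ.set i (σ.mem (σ.mem j)))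
  | store (i j : ℕ) (σ : State) : Exec (.store i j) σ 1 (σ.set (σ.mem i) (σ.mem j))
  | write (i : ℕ) (σ : State) : Exec (.write i) σ 1 ⟨σ.mem, σ.out ++ [σ.mem i]⟩
  | seq {P Q : Ram} {σ ρ τ : State} {t u : ℕ} :
      Exec P σ t ρ → Exec Q ρ u τ → Exec (.seq P Q) σ (t + u) τ
  | ite_true {i : ℕ} {P Q : Ram} {σ τ : State} {t : ℕ} :
      σ.mem i ≠ 0 → Exec P σ t τ → Exec (.ite i P Q) σ (t + 1) τ
  | ite_false {i : ℕ} {P Q : Ram} {σ τ : State} {t : ℕ} :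
      σ.mem i = 0 → Exec Q σ t τ → Exec (.ite i P Q) σ (t + 1) τ
  | while_true {i : ℕ} {P : Ram} {σ ρ τ : State} {t u : ℕ} :
      σ.mem i ≠ 0 → Exec P σ t ρ → Exec (.while i P) ρ u τ →
        Exec (.while i P) σ (t + u + 1) τ
  | while_false {i : ℕ} {P : Ram} {σ : State} :
      σ.mem i = 0 → Exec (.while i P) σ 1 σ

/-- The initial state on input `(d, n)`: `R[0] = d`, `R[1] = n`, all other registers are zero,
and the output is empty. -/
def initial (d n : ℕ) : State :=
  ⟨fun i => if i = 0 then d else if i = 1 then n else 0, []⟩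

/-- On input `(d, n)`, the machine `P` halts after exactly `t` steps with output `w`. -/
def Outputs (P : Ram) (d n t : ℕ) (w : List ℕ) : Prop :=
  ∃ τ : State, Exec P (initial d n) t τ ∧ τ.out = w

end Ram

/-! A test is possible only at the end, so nothing directly forces a loop to run to its end. Budgets
force it instead. A pass (`step`) moves the content of a pool of counters, takes one unit from a
budget for each unit moved, and multiplies what it moves by `μ`. A budget of `1 + μ + … + μ^(R-1)`
times the content can be used up by at most `R` passes only if there are exactly `R` and each moves
everything. `balance` measures the deviation from this: it starts at `0`, never decreases
(`balance_pass`), and cannot be nonnegative at the end with an empty budget unless all was complete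
(`budget_exhausted`). One final zero thus certifies many intermediate zeros, and also the number of
passes.

The exponent `v` sits in counter `4`, and counters `0`, `1` hold `x`, `y` with `x + y = 4^v x`. An
increment is one pass that divides `x` by `4` before multiplying by `2`. An amplifier halves `x` and
turns `y` into a budget one level lower, which then suffices for exactly `2v + 1` doubling passes.
At level `0` these are `2v + 1` increments from exponent `0`, and `F_1(v) = 2v + 1`. At level `i +
1`, `v` of them rebuild exponent `v` and the other `v + 1` pay for amplifiers of level `i`, which
iterates `F_{i+1}` and gives `F_{i+2}(v)` (`bodySpec`). Lower budgets need no test of their own: the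
next complete pass one level up shows that they were empty, and therefore `Clean` is a conditional
statement.

For `d ≥ 2` the top budget is `(n + 2) 4^n x`: it pays for `n + 1` amplifiers with `μ = 1` and one
closing pass, and the exponent becomes `V = F_{d+1}(n)`. Now `y = (4^V - 1) x` is itself a budget
for `2V` doubling passes, two for each unit of the exponent. They build a ratio `2^V` while counter
`6` is doubled `V` times (`expo_sound`); doubling may fall short, but then `settle` cannot empty its
counters (`settle_sound`). For `d = 1`, `V = F_2(n)` is small enough to be written out. Conversely,
complete runs are built backwards from the desired final value (`amp_run`, `preamp_run`).

In prefix notation each level of an amplifier is a fixed word with three varying counter names,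
followed by the word of the level below. A machine prints it in bounded time per level, and as each
step writes at most one symbol, the time bound also bounds the size. -/

namespace Program

open Finsupp

/-! ### Runs as equations between configurations -/

theorem run_inc {c : ℕ} {α β : Config} : (inc c).Run α β ↔ β = α + single c 1 := by
  simp only [Run]
  constructor
  · rintro ⟨h1, h2⟩
    ext z
    by_cases hz : z = c
    · subst hz; simp [h2]
    · simp [h1 z hz, Ne.symm hz]
  · rintro rfl
    refine ⟨fun z hz => ?_, by simp⟩
    simp [Ne.symm hz]

theorem run_dec {c : ℕ} {α β : Config} : (dec c).Run α β ↔ α = β + single c 1 := by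
  simp only [Run]
  constructor
  · rintro ⟨h1, h2⟩
    ext z
    by_cases hz : z = c
    · subst hz; simp [h2]
    · simp [h1 z hz, Ne.symm hz]
  · rintro rfl
    refine ⟨fun z hz => ?_, by simp⟩
    simp [Ne.symm hz]

theorem run_test {c : ℕ} {α β : Config} : (test c).Run α β ↔ β = α ∧ α c = 0 := by
  simp only [Run]
  constructor
  · rintro ⟨h1, h2, h3⟩
    refine ⟨?_, h3⟩
    ext z
    by_cases hz : z = c
    · subst hz; rw [h2, h3]
    · exact (h1 z hz).symm
  · rintro ⟨rfl, h⟩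
    exact ⟨fun _ _ => rfl, h, h⟩

theorem run_seq {M N : Program} {α β : Config} :
    (seq M N).Run α β ↔ ∃ ρ, M.Run α ρ ∧ N.Run ρ β := Iff.rfl

theorem run_loop {M : Program} {α β : Config} :
    (loop M).Run α β ↔ Relation.ReflTransGen M.Run α β := Iff.rfl

/-- Runs never change a counter that the program does not use. -/
theorem Run.frame {M : Program} {α β : Config} (h : M.Run α β) {z : ℕ} (hz : z ∉ M.counters) :
    β z = α z := by
  induction M generalizing α β with
  | inc c => exact (h.1 z (by simpa [counters] using hz)).symm
  | dec c => exact (h.1 z (by simpa [counters] using hz)).symm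
  | test c => exact (h.1 z (by simpa [counters] using hz)).symm
  | loop M ih =>
    rw [run_loop] at h
    induction h with
    | refl => rfl
    | tail _ h2 ih2 => rw [ih h2 hz, ih2]
  | seq M N ihM ihN =>
    obtain ⟨ρ, h1, h2⟩ := h
    simp only [counters, Finset.mem_union, not_or] at hz
    rw [ihN h2 hz.2, ihM h1 hz.1]
  | or M N ihM ihN =>
    simp only [counters, Finset.mem_union, not_or] at hz
    rcases h with h | h
    · exact ihM h hz.1
    · exact ihN h hz.2

/-- Runs of test-free programs are monotone. -/
theorem Run.add_right {M : Program} (hM : M.TestFree) {α β : Config} (h : M.Run α β)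
    (γ : Config) : M.Run (α + γ) (β + γ) := by
  induction M generalizing α β with
  | inc c => rw [run_inc] at h ⊢; rw [h, add_right_comm]
  | dec c => rw [run_dec] at h ⊢; rw [h, add_right_comm]
  | test c => exact hM.elim
  | loop M ih =>
    rw [run_loop] at h ⊢
    induction h with
    | refl => exact .refl
    | tail _ h2 ih2 => exact ih2.tail (ih hM h2)
  | seq M N ihM ihN =>
    obtain ⟨ρ, h1, h2⟩ := h
    exact ⟨ρ + γ, ihM hM.1 h1, ihN hM.2 h2⟩
  | or M N ihM ihN =>
    rcases h with h | h
    · exact .inl (ihM hM.1 h)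
    · exact .inr (ihN hM.2 h)

/-- Complete runs are recorded only on the counters they involve; this places them in a larger
configuration and leaves two identities of configurations, usually for `abel`. -/
theorem Run.of_add {M : Program} (hM : M.TestFree) {u w : Config} (h : M.Run u w) (γ : Config)
    {α β : Config} (hα : α = u + γ) (hβ : β = w + γ) : M.Run α β := by
  subst hα hβ; exact h.add_right hM γ

/-- `m` increments of `c`, followed by `P`. -/
def incs (c : ℕ) : ℕ → Program → Program
  | 0, P => P
  | m + 1, P => seq (inc c) (incs c m P)

/-- `m` decrements of `c`, followed by `P`. -/
def decs (c : ℕ) : ℕ → Program → Program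
  | 0, P => P
  | m + 1, P => seq (dec c) (decs c m P)

theorem run_incs {c m : ℕ} {P : Program} {α β : Config} :
    (incs c m P).Run α β ↔ P.Run (α + single c m) β := by
  induction m generalizing α with
  | zero => simp [incs]
  | succ m ih =>
    simp only [incs, run_seq, run_inc, exists_eq_left, ih]
    rw [add_assoc, ← single_add, add_comm 1 m]

theorem run_decs {c m : ℕ} {P : Program} {α β : Config} :
    (decs c m P).Run α β ↔ ∃ ρ, α = ρ + single c m ∧ P.Run ρ β := by
  induction m generalizing α with
  | zero => simp [decs]
  | succ m ih =>
    simp only [decs, run_seq, run_dec, ih]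
    constructor
    · rintro ⟨_, rfl, ρ, rfl, h⟩
      exact ⟨ρ, by rw [add_assoc, ← single_add], h⟩
    · rintro ⟨ρ, rfl, h⟩
      exact ⟨ρ + single c m, by rw [add_assoc, ← single_add], ρ, rfl, h⟩

/-- `M` replaces a part `u` of the configuration by `w`. -/
def Replaces (M : Program) (u w : Config) : Prop :=
  ∀ α β, M.Run α β ↔ ∃ γ, α = γ + u ∧ β = γ + w

theorem Replaces.run {M : Program} {u w : Config} (h : M.Replaces u w) (γ : Config) :
    M.Run (γ + u) (γ + w) := (h _ _).2 ⟨γ, rfl, rfl⟩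

theorem Replaces.loop_run {M : Program} {u w : Config} (h : M.Replaces u w) (i : ℕ) (γ : Config) :
    (loop M).Run (γ + i • u) (γ + i • w) := by
  rw [run_loop]
  induction i generalizing γ with
  | zero => simpa using Relation.ReflTransGen.refl
  | succ i ih =>
    have h1 := h.run (γ + i • u)
    have h2 := ih (γ + w)
    rw [add_right_comm] at h1
    rw [add_right_comm _ w, add_right_comm _ w] at h2
    rw [succ_nsmul, succ_nsmul, ← add_assoc, ← add_assoc]
    refine .head ?_ h2
    rw [add_right_comm γ u] at h1
    exact h1

/-- Soundness needs only the net effect of a loop. Writing it without subtraction makes each counter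
a linear equation for `omega`. -/
theorem Replaces.loop_eq {M : Program} {u w : Config} (h : M.Replaces u w) {α β : Config}
    (hr : (loop M).Run α β) : ∃ i : ℕ, β + i • u = α + i • w := by
  rw [run_loop] at hr
  induction hr with
  | refl => exact ⟨0, by simp⟩
  | tail _ h2 ih =>
    obtain ⟨i, hi⟩ := ih
    obtain ⟨γ, rfl, rfl⟩ := (h _ _).1 h2
    refine ⟨i + 1, ?_⟩
    rw [succ_nsmul, succ_nsmul, ← add_assoc (_ : Config) _ w, ← hi]
    abel

theorem replaces_inc (c : ℕ) : (inc c).Replaces 0 (single c 1) := by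
  intro α β; simp [run_inc]

theorem Replaces.incs {P : Program} {w : Config} (h : P.Replaces 0 w) (c m : ℕ) :
    (incs c m P).Replaces 0 (single c m + w) := by
  intro α β
  rw [run_incs, h]
  simp [add_assoc]

theorem Replaces.seq_inc {P : Program} {w : Config} (h : P.Replaces 0 w) (c : ℕ) :
    (seq (inc c) P).Replaces 0 (single c 1 + w) := h.incs c 1

theorem Replaces.decs {P : Program} {u w : Config} (h : P.Replaces u w) (c m : ℕ) :
    (decs c m P).Replaces (u + single c m) w := by
  intro α β
  rw [run_decs]
  constructor
  · rintro ⟨ρ, rfl, hr⟩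
    obtain ⟨γ, rfl, rfl⟩ := (h _ _).1 hr
    exact ⟨γ, add_assoc _ _ _, rfl⟩
  · rintro ⟨γ, rfl, rfl⟩
    exact ⟨γ + u, (add_assoc _ _ _).symm, h.run γ⟩

theorem Replaces.seq_dec {P : Program} {u w : Config} (h : P.Replaces u w) (c : ℕ) :
    (seq (dec c) P).Replaces (u + single c 1) w := h.decs c 1

/-! ### The basic step -/

/-- Transfer from `c` to `z`. -/
def move (c z : ℕ) : Program := loop (seq (dec c) (inc z))

/-- Transfer from `c` to `c'`, multiplied by `μ` and paid for by `o`. -/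
def paidMove (μ o c c' : ℕ) : Program :=
  loop (seq (dec c) (seq (dec o) (incs c' (μ - 1) (inc c'))))

/-- Divide `x` by `a`, putting the remaining units to `y`; the content of `x` and `y` then passes
through `x'` and `y'` to `x` and `t`, multiplied by `μ` and paid for by `o`. -/
def step (a μ x y x' y' o t : ℕ) : Program :=
  seq (loop (decs x a (incs y' (a - 1) (inc x')))) (seq (move y y')
    (seq (paidMove μ o x' x) (paidMove μ o y' t)))

theorem run_move {c c' : ℕ} {α β : Config} (h : (move c c').Run α β) :
    ∃ i, β + single c i = α + single c' i := by
  obtain ⟨i, hi⟩ := (((replaces_inc c').seq_dec c).loop_eq h)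
  exact ⟨i, by simpa using hi⟩

theorem move_run (c c' i : ℕ) (γ : Config) :
    (move c c').Run (γ + single c i) (γ + single c' i) := by
  simpa [move] using ((replaces_inc c').seq_dec c).loop_run i γ

theorem run_paidMove {μ o c c' : ℕ} (hμ : 1 ≤ μ) {α β : Config} (h : (paidMove μ o c c').Run α β) :
    ∃ i, β + single o i + single c i = α + single c' (μ * i) := by
  obtain ⟨i, hi⟩ := (((((replaces_inc c').incs c' (μ - 1)).seq_dec o).seq_dec c).loop_eq h)
  refine ⟨i, ?_⟩
  rw [← single_add, Nat.sub_add_cancel hμ] at hi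
  simpa [add_assoc, mul_comm] using hi

theorem paidMove_run {μ : ℕ} (hμ : 1 ≤ μ) (o c c' i : ℕ) (γ : Config) :
    (paidMove μ o c c').Run (γ + single o i + single c i) (γ + single c' (μ * i)) := by
  have := (((((replaces_inc c').incs c' (μ - 1)).seq_dec o).seq_dec c).loop_run i γ)
  rw [← single_add, Nat.sub_add_cancel hμ] at this
  simpa [paidMove, add_assoc, mul_comm] using this

theorem divide_replaces (a x x' y' : ℕ) :
    (decs x a (incs y' (a - 1) (inc x'))).Replaces (single x a)
      (single y' (a - 1) + single x' 1) := by
  simpa using ((replaces_inc x').incs y' (a - 1)).decs x a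

/-- The total content of a set of counters. -/
def total (Z : Finset ℕ) (α : Config) : ℕ := ∑ z ∈ Z, α z

theorem total_add (Z : Finset ℕ) (α β : Config) : total Z (α + β) = total Z α + total Z β := by
  simp [total, Finset.sum_add_distrib]

theorem total_single (Z : Finset ℕ) (c m : ℕ) :
    total Z (single c m) = if c ∈ Z then m else 0 := by
  simp [total, single_apply, Finset.sum_ite_eq]

theorem le_total {Z : Finset ℕ} {z : ℕ} (hz : z ∈ Z) (α : Config) : α z ≤ total Z α :=
  Finset.single_le_sum (f := fun z => α z) (fun _ _ => Nat.zero_le _) hz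

theorem add_le_total {Z : Finset ℕ} {u z : ℕ} (hu : u ∈ Z) (hz : z ∈ Z) (h : u ≠ z) (α : Config) :
    α u + α z ≤ total Z α := by
  rw [← Finset.sum_pair (f := fun z => α z) h]
  exact Finset.sum_le_sum_of_subset (by simp [Finset.insert_subset_iff, hu, hz])

theorem add_add_le_total {Z : Finset ℕ} {u v z : ℕ} (hu : u ∈ Z) (hv : v ∈ Z) (hz : z ∈ Z)
    (h : u ≠ v) (h1 : z ≠ u) (h2 : z ≠ v) (α : Config) :
    α u + α v + α z ≤ total Z α := by
  have := Finset.sum_le_sum_of_subset (f := fun z => α z)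
    (show ({u, v, z} : Finset ℕ) ⊆ Z by simp [Finset.insert_subset_iff, hu, hv, hz])
  rw [Finset.sum_insert (by simp [h, h1.symm]), Finset.sum_pair h2.symm] at this
  rw [total]; omega

/-- Division and transfer preserve the total of `Z`, and only what has reached `x'` and `y'` can be
paid for. Hence the payment `e` is at most the total, with equality only if all content passes
through `x'` and `y'`: the division left no remainder, every loop was exhausted, and the rest of `Z`
was empty beforehand. -/
theorem step_sound {a μ x y x' y' o t : ℕ} {Z : Finset ℕ} (ha : 1 ≤ a) (hμ : 1 ≤ μ)
    (hn : [x, y, x', y'].Nodup) (hx : x ∈ Z) (hy : y ∈ Z) (hx' : x' ∈ Z) (hy' : y' ∈ Z)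
    (ht : t ∈ Z) (ho : o ∉ Z) (htx : t ≠ x) (htx' : t ≠ x') (hty' : t ≠ y') {α β : Config}
    (h : (step a μ x y x' y' o t).Run α β) :
    ∃ e, β o + e = α o ∧ total Z β + e = total Z α + μ * e ∧ e ≤ total Z α ∧
      (e = total Z α → (∀ z ∈ Z, z ≠ x → z ≠ y → z ≠ x' → z ≠ y' → α z = 0) ∧
        (α x' = 0 → α y' = 0 → ∃ i, α x = a * i ∧ β x = μ * i ∧ β t = μ * (α y + (a - 1) * i) ∧
          ∀ z ∈ Z, z ≠ x → z ≠ t → β z = 0)) := by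
  obtain ⟨ρ₁, h1, ρ₂, h2, ρ₃, h3, h4⟩ := h
  obtain ⟨i, e1⟩ := (divide_replaces a x x' y').loop_eq h1
  obtain ⟨m, e2⟩ := run_move h2
  obtain ⟨p, e3⟩ := run_paidMove hμ h3
  obtain ⟨q, e4⟩ := run_paidMove hμ h4
  simp only [List.nodup_cons, List.mem_cons, List.not_mem_nil, or_false, not_or,
    List.nodup_nil, and_true, not_false_eq_true] at hn
  obtain ⟨⟨nxy, nxx', nxy'⟩, ⟨nyx', nyy'⟩, nx'y'⟩ := hn
  have hox : o ≠ x := fun h => ho (h ▸ hx)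
  have hoy : o ≠ y := fun h => ho (h ▸ hy)
  have hox' : o ≠ x' := fun h => ho (h ▸ hx')
  have hoy' : o ≠ y' := fun h => ho (h ▸ hy')
  have hot : o ≠ t := fun h => ho (h ▸ ht)
  simp only [smul_add, smul_single, smul_eq_mul] at e1
  have T1 := congrArg (total Z) e1
  have T2 := congrArg (total Z) e2
  have T3 := congrArg (total Z) e3
  have T4 := congrArg (total Z) e4
  simp only [total_add, total_single, hx, hy, hx', hy', ht, ho, if_true, if_false] at T1 T2 T3 T4
  have V (z : ℕ) := And.intro (DFunLike.congr_fun e1 z) <| And.intro (DFunLike.congr_fun e2 z)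
    (And.intro (DFunLike.congr_fun e3 z) (DFunLike.congr_fun e4 z))
  simp only [Finsupp.add_apply, single_apply] at V
  have Vo := V o
  have Vx := V x
  have Vy := V y
  have Vx' := V x'
  have Vy' := V y'
  have Vt := V t
  have mi : i * a = i * (a - 1) + i := by
    obtain ⟨a, rfl⟩ : ∃ b, a = b + 1 := ⟨a - 1, by omega⟩
    simp [mul_add]
  simp only [nxy, nxx', nxy', nyx', nyy', nx'y', hox, hoy, hox', hoy', hot, htx, htx', hty',
    Ne.symm nxy, Ne.symm nxx', Ne.symm nxy', Ne.symm nyx', Ne.symm nyy', Ne.symm nx'y', hox.symm,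
    hoy.symm, hox'.symm, hoy'.symm, hot.symm, htx.symm, htx'.symm, hty'.symm,
    if_true, if_false] at Vo Vx Vy Vx' Vy' Vt
  have hle := add_le_total hx' hy' nx'y' ρ₂
  refine ⟨p + q, by omega, by rw [mul_add]; omega, by omega, fun he => ?_⟩
  -- Here `e` equals the total of `ρ₂`, so `x'` and `y'` already account for all of it.
  have hz0 : ∀ z ∈ Z, z ≠ x' → z ≠ y' → ρ₂ z = 0 := fun z hz h1 h2 => by
    have := add_add_le_total hx' hy' hz nx'y' h1 h2 ρ₂
    omega
  have hp : p = ρ₂ x' := by omega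
  have hq : q = ρ₂ y' := by omega
  have hx0 := hz0 x hx nxx' nxy'
  have hy0 := hz0 y hy nyx' nyy'
  refine ⟨fun z hz z1 z2 z3 z4 => ?_, fun a1 a2 => ⟨i, ?_, ?_, ?_, fun z hz z1 z2 => ?_⟩⟩
  · have Vz := V z
    have := hz0 z hz z3 z4
    simp only [Ne.symm z1, Ne.symm z2, Ne.symm z3, Ne.symm z4, if_false] at Vz
    omega
  · rw [mul_comm]; omega
  · have : p = i := by omega
    subst this; omega
  · have : q = α y + (a - 1) * i := by rw [mul_comm]; omega
    rw [← this]
    -- The target may be `y` itself (increments) or a lower budget (amplifiers).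
    by_cases hty : t = y
    · subst hty; simp only [if_true] at Vt; omega
    · have := hz0 t ht htx' hty'
      simp only [Ne.symm hty, if_false] at Vt; omega
  · have Vz := V z
    have hoz : o ≠ z := fun h => ho (h ▸ hz)
    by_cases z3 : z = x'
    · subst z3; omega
    by_cases z4 : z = y'
    · subst z4; omega
    have := hz0 z hz z3 z4
    simp only [Ne.symm z1, Ne.symm z2, Ne.symm z3, Ne.symm z4, hoz, if_false] at Vz
    omega

theorem counters_incs (c m : ℕ) (P : Program) :
    (incs c m P).counters = if m = 0 then P.counters else insert c P.counters := by
  induction m with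
  | zero => simp [incs]
  | succ m ih =>
    rw [incs, counters, counters, ih, if_neg (Nat.succ_ne_zero m)]
    split_ifs <;> ext z <;> simp

theorem counters_decs (c m : ℕ) (P : Program) :
    (decs c m P).counters = if m = 0 then P.counters else insert c P.counters := by
  induction m with
  | zero => simp [decs]
  | succ m ih =>
    rw [decs, counters, counters, ih, if_neg (Nat.succ_ne_zero m)]
    split_ifs <;> ext z <;> simp

theorem counters_move (c c' : ℕ) : (move c c').counters = {c, c'} := by
  simp [move, counters]

theorem counters_paidMove (μ o c c' : ℕ) : (paidMove μ o c c').counters = {c, o, c'} := by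
  simp only [paidMove, counters, counters_incs]
  split_ifs <;> ext z <;> simp <;> tauto

theorem counters_step {a : ℕ} (ha : 1 ≤ a) (μ x y x' y' o t : ℕ) :
    (step a μ x y x' y' o t).counters = {x, y, x', y', o, t} := by
  simp only [step, counters, counters_move, counters_paidMove, counters_decs, counters_incs]
  split_ifs <;> first | omega | (ext z; simp; tauto)

/-! ### Potentials -/

/-- The balance of the budget `o` with respect to `R` passes through the counters of `Z`, each of
which multiplies their content by `μ`. -/
def balance (μ : ℕ) (Z : Finset ℕ) (o R : ℕ) (α : Config) : ℤ :=
  α o - (∑ i ∈ Finset.range R, (μ : ℤ) ^ i) * total Z α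

/-- Every run of `M` pays for at most `k` passes, and if it pays for exactly `k` passes then it
leads from `P` to `Q`. -/
def Pays (Φ : ℕ → Config → ℤ) (k : ℕ) (M : Program) (P Q : Config → Prop) : Prop :=
  ∀ α β, M.Run α β → ∀ R, Φ (R + k) α ≤ Φ R β ∧ (Φ (R + k) α = Φ R β → P α → Q β)

/-- Two inequalities compose, and equality of the outer terms forces equality in both. -/
theorem Pays.seq {Φ : ℕ → Config → ℤ} {k l : ℕ} {M N : Program} {P Q S : Config → Prop}
    (hM : Pays Φ k M P Q) (hN : Pays Φ l N Q S) : Pays Φ (l + k) (M.seq N) P S := by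
  rintro α β ⟨ρ, h1, h2⟩ R
  obtain ⟨a1, a2⟩ := hM _ _ h1 (R + l)
  obtain ⟨b1, b2⟩ := hN _ _ h2 R
  rw [← add_assoc]
  exact ⟨a1.trans b1, fun h p => b2 (by omega) (a2 (by omega) p)⟩

theorem Pays.of_eq {Φ : ℕ → Config → ℤ} {M : Program} {P Q : Config → Prop}
    (h : ∀ α β, M.Run α β → (∀ R, Φ R β = Φ R α) ∧ (P α → Q β)) : Pays Φ 0 M P Q :=
  fun α β hr R => ⟨((h α β hr).1 R).ge, fun _ => (h α β hr).2⟩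

theorem balance_congr {μ : ℕ} {Z : Finset ℕ} {o : ℕ} {α β : Config} (h1 : β o = α o)
    (h2 : total Z β = total Z α) (R : ℕ) : balance μ Z o R β = balance μ Z o R α := by
  rw [balance, balance, h1, h2]

/-- By the geometric sum, the balance grows by exactly `μ^R` times the content that the pass failed
to move. -/
theorem balance_pass {μ : ℕ} (hμ : 1 ≤ μ) {Z : Finset ℕ} {o e : ℕ} {α β : Config}
    (h1 : β o + e = α o) (h2 : total Z β + e = total Z α + μ * e) (h3 : e ≤ total Z α) (R : ℕ) :
    balance μ Z o (R + 1) α ≤ balance μ Z o R β ∧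
      (balance μ Z o (R + 1) α = balance μ Z o R β → e = total Z α) := by
  have key : balance μ Z o R β - balance μ Z o (R + 1) α = (μ : ℤ) ^ R * (total Z α - e) := by
    have g : (∑ i ∈ Finset.range R, (μ : ℤ) ^ i) * (μ - 1) = (μ : ℤ) ^ R - 1 := geom_sum_mul _ _
    simp only [balance, Finset.sum_range_succ]
    zify at h1 h2
    rw [← h1, eq_sub_of_add_eq h2]
    linear_combination (-(e : ℤ)) * g
  have hp : (0 : ℤ) < (μ : ℤ) ^ R := by positivity
  have h3' : (0 : ℤ) ≤ total Z α - e := by omega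
  refine ⟨by nlinarith, fun he => ?_⟩
  rw [he, sub_self] at key
  have := (mul_eq_zero.1 key.symm).resolve_left hp.ne'
  omega

theorem step_pays {a μ x y x' y' o t : ℕ} {Z : Finset ℕ} (ha : 1 ≤ a) (hμ : 1 ≤ μ)
    (hn : [x, y, x', y'].Nodup) (hx : x ∈ Z) (hy : y ∈ Z) (hx' : x' ∈ Z) (hy' : y' ∈ Z)
    (ht : t ∈ Z) (ho : o ∉ Z) (htx : t ≠ x) (htx' : t ≠ x') (hty' : t ≠ y')
    {P Q : Config → Prop}
    (h : ∀ α β, (∀ z, z ∉ ({x, y, x', y', o, t} : Finset ℕ) → β z = α z) → P α →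
      (∀ z ∈ Z, z ≠ x → z ≠ y → z ≠ x' → z ≠ y' → α z = 0) →
      (α x' = 0 → α y' = 0 → ∃ i, α x = a * i ∧ β x = μ * i ∧ β t = μ * (α y + (a - 1) * i) ∧
          ∀ z ∈ Z, z ≠ x → z ≠ t → β z = 0) → Q β) :
    Pays (balance μ Z o) 1 (step a μ x y x' y' o t) P Q := by
  intro α β hr R
  obtain ⟨e, e1, e2, e3, e4⟩ := step_sound ha hμ hn hx hy hx' hy' ht ho htx htx' hty' hr
  obtain ⟨b1, b2⟩ := balance_pass hμ e1 e2 e3 R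
  refine ⟨b1, fun hb hp => ?_⟩
  obtain ⟨f1, f2⟩ := e4 (b2 hb)
  exact h α β (fun z hz => hr.frame (by rwa [counters_step ha])) hp f1 f2

/-- Iterations of a program that pays for `k` passes, controlled by the counter `c`. -/
theorem Pays.loop_dec {Φ : ℕ → Config → ℤ} {k c : ℕ} {M : Program} {P : ℕ → Config → Prop}
    (hM : ∀ i, Pays Φ k M (P i) (P (i + 1))) (hc : c ∉ M.counters)
    (hΦ : ∀ α β : Config, (∀ z, z ≠ c → β z = α z) → ∀ R, Φ R β = Φ R α)
    (hP : ∀ i, ∀ α β : Config, (∀ z, z ≠ c → β z = α z) → P i α → P i β)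
    {α β : Config} (h : (loop (Program.seq (dec c) M)).Run α β) :
    ∃ q, β c + q = α c ∧ ∀ R, Φ (R + k * q) α ≤ Φ R β ∧
      (Φ (R + k * q) α = Φ R β → P 0 α → P q β) := by
  rw [run_loop] at h
  induction h with
  | refl => exact ⟨0, by simp, fun R => by simp⟩
  | @tail ρ β _ h2 ih =>
    obtain ⟨q, hq, ih⟩ := ih
    obtain ⟨τ, h3, h4⟩ := h2
    have hτ : ∀ z, z ≠ c → τ z = ρ z := fun z hz => (h3.1 z hz).symm
    refine ⟨q + 1, ?_, fun R => ?_⟩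
    · have := h4.frame hc
      have := h3.2
      omega
    · obtain ⟨a1, a2⟩ := ih (R + k)
      obtain ⟨b1, b2⟩ := hM q _ _ h4 R
      rw [hΦ ρ τ hτ] at b1 b2
      rw [show R + k * (q + 1) = R + k + k * q by ring]
      exact ⟨a1.trans b1, fun e p => b2 (by omega) (hP _ _ _ hτ (a2 (by omega) p))⟩

/-! ### Amplification -/

/-- Increment the exponent. -/
def incr (o : ℕ) : Program := seq (step 4 2 0 1 2 3 o 1) (inc 4)

/-- The part of the amplifiers that is controlled by their own budget. -/
def ampBody : ℕ → Program
  | 0 => seq (loop (seq (dec 4) (inc 6)))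
      (seq (loop (seq (dec 6) (seq (incr 5) (incr 5)))) (incr 5))
  | i + 1 => seq (loop (seq (dec 4) (seq (inc (8 + 2 * i)) (inc 6)))) (seq (inc (8 + 2 * i))
      (seq (loop (seq (dec 6) (incr (7 + 2 * i))))
        (loop (seq (dec (8 + 2 * i))
          (seq (step 2 2 0 1 2 3 (7 + 2 * i) (5 + 2 * i)) (ampBody i))))))

/-- Amplifier that replaces the exponent `v` by `fastF (i + 1) v`. -/
def amp (i μ : ℕ) : Program := seq (step 2 μ 0 1 2 3 (7 + 2 * i) (5 + 2 * i)) (ampBody i)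

theorem ampBody_succ (i : ℕ) : ampBody (i + 1) =
    seq (loop (seq (dec 4) (seq (inc (8 + 2 * i)) (inc 6)))) (seq (inc (8 + 2 * i))
      (seq (loop (seq (dec 6) (incr (7 + 2 * i))))
        (loop (seq (dec (8 + 2 * i)) (amp i 2))))) := rfl

/-- The counters `x`, `y`, `x'`, `y'` and the budgets below level `i`. -/
def pool (i : ℕ) : Finset ℕ := {0, 1, 2, 3} ∪ (Finset.range i).image (fun k => 5 + 2 * k)

theorem mem_pool {i z : ℕ} : z ∈ pool i ↔ z ≤ 3 ∨ ∃ k < i, z = 5 + 2 * k := by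
  simp only [pool, Finset.mem_union, Finset.mem_insert, Finset.mem_singleton, Finset.mem_image,
    Finset.mem_range, eq_comm (a := z)]
  refine or_congr (by omega) Iff.rfl

theorem total_pool_succ (i : ℕ) (α : Config) :
    total (pool (i + 1)) α = total (pool i) α + α (5 + 2 * i) := by
  have : pool (i + 1) = insert (5 + 2 * i) (pool i) := by
    rw [pool, Finset.range_add_one, Finset.image_insert, Finset.union_insert, pool]
  rw [this, total, Finset.sum_insert, add_comm, total]
  rw [mem_pool]
  grind

theorem total_pool_zero (α : Config) : total (pool 0) α = α 0 + α 1 + α 2 + α 3 := by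
  simp [total, pool, add_assoc]

theorem counters_incr (o : ℕ) : (incr o).counters = {0, 1, 2, 3, 4, o} := by
  rw [incr, counters, counters_step (by norm_num)]
  ext z; simp [counters]; tauto

theorem counters_ampBody (i : ℕ) : (ampBody i).counters = Finset.range (7 + 2 * i) := by
  induction i with
  | zero =>
    simp only [ampBody, counters, counters_incr]
    decide
  | succ i ih =>
    simp only [ampBody, counters, counters_incr, ih, counters_step (show 1 ≤ 2 by norm_num)]
    ext z
    simp only [Finset.mem_union, Finset.mem_insert, Finset.mem_singleton, Finset.mem_range]
    omega

theorem counters_amp (i μ : ℕ) : (amp i μ).counters = Finset.range (8 + 2 * i) := by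
  rw [amp, counters, counters_ampBody, counters_step (by norm_num)]
  ext z
  simp only [Finset.mem_union, Finset.mem_insert, Finset.mem_singleton, Finset.mem_range]
  omega

/-- A run with multiplier `2` moves content between the budget and the counters it pays for. -/
theorem step_two_total {a x y x' y' o t : ℕ} {Z : Finset ℕ} (ha : 1 ≤ a)
    (hn : [x, y, x', y'].Nodup) (hx : x ∈ Z) (hy : y ∈ Z) (hx' : x' ∈ Z) (hy' : y' ∈ Z)
    (ht : t ∈ Z) (ho : o ∉ Z) (htx : t ≠ x) (htx' : t ≠ x') (hty' : t ≠ y') {α β : Config}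
    (h : (step a 2 x y x' y' o t).Run α β) : total Z β + β o = total Z α + α o := by
  obtain ⟨e, e1, e2, _⟩ := step_sound ha one_le_two hn hx hy hx' hy' ht ho htx htx' hty' h
  omega

theorem total_loop {Z : Finset ℕ} {M : Program}
    (hM : ∀ α β, M.Run α β → total Z β = total Z α) {α β : Config} (h : (loop M).Run α β) :
    total Z β = total Z α := by
  rw [run_loop] at h
  induction h with
  | refl => rfl
  | tail _ h2 ih => rw [hM _ _ h2, ih]

/-! ### Conservation of content under doubling passes -/

theorem total_congr {Z : Finset ℕ} {α β : Config} (h : ∀ z ∈ Z, β z = α z) :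
    total Z β = total Z α := Finset.sum_congr rfl h

theorem budget_notMem_pool (i : ℕ) : 5 + 2 * i ∉ pool i := by
  rw [mem_pool]; grind

theorem even_notMem_pool {i c : ℕ} (hc : c % 2 = 0) (h : 4 ≤ c) : c ∉ pool i := by
  rw [mem_pool]; grind

theorem le_three_mem_pool {i c : ℕ} (hc : c ≤ 3) : c ∈ pool i := mem_pool.2 (.inl hc)

theorem budget_mem_pool {i k : ℕ} (hk : k < i) : 5 + 2 * k ∈ pool i :=
  mem_pool.2 (.inr ⟨k, hk, rfl⟩)

theorem total_inc {Z : Finset ℕ} {c : ℕ} (hc : c ∉ Z) {α β : Config} (h : (inc c).Run α β) :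
    total Z β = total Z α :=
  total_congr fun z hz => h.frame (by simp [counters]; rintro rfl; exact hc hz)

theorem total_dec {Z : Finset ℕ} {c : ℕ} (hc : c ∉ Z) {α β : Config} (h : (dec c).Run α β) :
    total Z β = total Z α :=
  total_congr fun z hz => h.frame (by simp [counters]; rintro rfl; exact hc hz)

theorem total_incr {i : ℕ} {α β : Config} (h : (incr (5 + 2 * i)).Run α β) :
    total (pool (i + 1)) β = total (pool (i + 1)) α := by
  obtain ⟨ρ, h1, h2⟩ := h
  rw [total_inc (even_notMem_pool rfl le_rfl) h2, total_pool_succ, total_pool_succ]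
  exact step_two_total (by norm_num) (by decide) (le_three_mem_pool (by norm_num))
    (le_three_mem_pool (by norm_num)) (le_three_mem_pool (by norm_num))
    (le_three_mem_pool (by norm_num)) (le_three_mem_pool (by norm_num)) (budget_notMem_pool i)
    (by norm_num) (by norm_num) (by norm_num) h1

theorem total_step_two {i : ℕ} {α β : Config}
    (h : (step 2 2 0 1 2 3 (7 + 2 * i) (5 + 2 * i)).Run α β) :
    total (pool (i + 2)) β = total (pool (i + 2)) α := by
  rw [total_pool_succ (i + 1), total_pool_succ (i + 1)]
  rw [show 7 + 2 * i = 5 + 2 * (i + 1) by ring] at h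
  exact step_two_total (by norm_num) (by decide) (le_three_mem_pool (by norm_num))
    (le_three_mem_pool (by norm_num)) (le_three_mem_pool (by norm_num))
    (le_three_mem_pool (by norm_num)) (budget_mem_pool (by omega)) (budget_notMem_pool (i + 1))
    (by omega) (by omega) (by omega) h

/-- Every pass inside doubles, so it only shifts content from a budget to the counters below. This
has two uses: the balance of the next higher budget ignores `ampBody i`, and once the budget of
level `i` is empty, the pool below it is known to be nonempty. -/
theorem total_ampBody {i : ℕ} {α β : Config} (h : (ampBody i).Run α β) :
    total (pool (i + 1)) β = total (pool (i + 1)) α := by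
  induction i generalizing α β with
  | zero =>
    obtain ⟨ρ, h1, τ, h2, h3⟩ := h
    rw [total_incr (i := 0) h3, total_loop _ h2, total_loop _ h1]
    · rintro α β ⟨ρ, h1, h2⟩
      rw [total_inc (even_notMem_pool rfl (by norm_num)) h2,
        total_dec (even_notMem_pool rfl (by norm_num)) h1]
    · rintro α β ⟨ρ, h1, τ, h2, h3⟩
      rw [total_incr (i := 0) h3, total_incr (i := 0) h2,
        total_dec (even_notMem_pool rfl (by norm_num)) h1]
  | succ i ih =>
    obtain ⟨ρ, h1, τ, h2, σ, h3, h4⟩ := h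
    have hc : 8 + 2 * i ∉ pool (i + 1 + 1) := even_notMem_pool (by omega) (by omega)
    have h6 : 6 ∉ pool (i + 1 + 1) := even_notMem_pool rfl (by norm_num)
    rw [total_loop _ h4, total_loop _ h3, total_inc hc h2, total_loop _ h1]
    · rintro α β ⟨ρ, h1, τ, h2, h3⟩
      rw [total_inc h6 h3, total_inc hc h2, total_dec (even_notMem_pool rfl (by norm_num)) h1]
    · rintro α β ⟨ρ, h1, h2⟩
      rw [show 7 + 2 * i = 5 + 2 * (i + 1) by ring] at h2
      rw [total_incr h2, total_dec h6 h1]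
    · rintro α β ⟨ρ, h1, τ, h2, h3⟩
      -- The lower body does not touch the budget of level `i + 1`, so the induction hypothesis
      -- extends to the larger pool.
      have : β (7 + 2 * i) = τ (7 + 2 * i) := h3.frame (by rw [counters_ampBody]; simp)
      rw [total_pool_succ, ih h3, show 5 + 2 * (i + 1) = 7 + 2 * i by ring, this,
        show 7 + 2 * i = 5 + 2 * (i + 1) by ring, ← total_pool_succ, total_step_two h2,
        total_dec hc h1]

/-- The counters `x`, `y` have ratio `4 ^ E - 1`, and the exponent is `v`. -/
structure Ratio (E v : ℕ) (α : Config) : Prop where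
  pos : 1 ≤ α 0
  sum : α 0 + α 1 = 4 ^ E * α 0
  two : α 2 = 0
  three : α 3 = 0
  four : α 4 = v

/-- Provided that all budgets up to level `i` are used up, the exponent is `v` and all controls up
to level `i` are zero. -/
def Clean (i v : ℕ) (α : Config) : Prop :=
  (∀ k ≤ i, α (5 + 2 * k) = 0) → Ratio v v α ∧ ∀ k ≤ i, α (6 + 2 * k) = 0

theorem Ratio.congr {E v : ℕ} {α β : Config} (h : Ratio E v α) (h' : ∀ z ≤ 4, β z = α z) :
    Ratio E v β := by
  obtain ⟨a, b, c, d, e⟩ := h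
  exact ⟨by rwa [h' 0 (by norm_num)], by rwa [h' 0 (by norm_num), h' 1 (by norm_num)],
    by rwa [h' 2 (by norm_num)], by rwa [h' 3 (by norm_num)], by rwa [h' 4 (by norm_num)]⟩

/-- A complete pass takes `x = 4j` and `y` to `2j` and `2(y + 3j)`, whose sum is `2(4j + y) =
4^(E+1) · 2j`. The indices `E` and `v` are separate because, in a run that copies the exponent
incompletely, the two do not agree. -/
theorem incr_pays (i E v : ℕ) : Pays (balance 2 (pool i) (5 + 2 * i)) 1 (incr (5 + 2 * i))
    (Ratio E v) (Ratio (E + 1) (v + 1)) := by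
  have h1 : Pays (balance 2 (pool i) (5 + 2 * i)) 1 (step 4 2 0 1 2 3 (5 + 2 * i) 1)
      (Ratio E v) (Ratio (E + 1) v) := by
    refine step_pays (by norm_num) (by norm_num) (by decide) (le_three_mem_pool (by norm_num))
      (le_three_mem_pool (by norm_num)) (le_three_mem_pool (by norm_num))
      (le_three_mem_pool (by norm_num)) (le_three_mem_pool (by norm_num)) (budget_notMem_pool i)
      (by norm_num) (by norm_num) (by norm_num) ?_
    intro α β hf hα _ h
    obtain ⟨j, a0, b0, b1, hz⟩ := h hα.two hα.three
    have := hα.pos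
    have hs := hα.sum
    refine ⟨by omega, ?_, hz 2 (le_three_mem_pool (by norm_num)) (by norm_num) (by norm_num),
      hz 3 (le_three_mem_pool (by norm_num)) (by norm_num) (by norm_num), ?_⟩
    · rw [b0, b1]
      rw [a0] at hs
      rw [pow_succ]
      linarith
    · rw [hf 4 (by simp; omega), hα.four]
  have h2 : Pays (balance 2 (pool i) (5 + 2 * i)) 0 (inc 4)
      (Ratio (E + 1) v) (Ratio (E + 1) (v + 1)) := by
    refine Pays.of_eq fun α β h => ⟨balance_congr (h.frame (by simp [counters]; omega))
      (total_inc (even_notMem_pool rfl le_rfl) h), fun hα => ?_⟩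
    have hf : ∀ z, z ≠ 4 → β z = α z := fun z hz => (h.1 z hz).symm
    refine ⟨by rw [hf 0 (by norm_num)]; exact hα.pos,
      by rw [hf 0 (by norm_num), hf 1 (by norm_num)]; exact hα.sum,
      by rw [hf 2 (by norm_num)]; exact hα.two, by rw [hf 3 (by norm_num)]; exact hα.three, ?_⟩
    rw [h.2, hα.four]
  simpa [incr] using h1.seq h2

theorem balance_two_eq {Z : Finset ℕ} {o R : ℕ} {α : Config} :
    balance 2 Z o R α = α o - ((2 : ℤ) ^ R - 1) * total Z α := by
  have g := geom_sum_mul (2 : ℤ) R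
  norm_num at g
  simp [balance, g]

/-- Correctness of `ampBody i`. -/
def BodySpec (i : ℕ) : Prop := ∀ V α β, (ampBody i).Run α β → 1 ≤ α 0 → α 1 = 0 → α 2 = 0 →
  α 3 = 0 → α 4 = V → (∀ k < i, α (5 + 2 * k) = 0) → (∀ k ≤ i, α (6 + 2 * k) = 0) →
  α 0 + α (5 + 2 * i) = 2 ^ (2 * V + 1) * α 0 → Clean i (fastF (i + 1) V) β

/-- A complete pass takes `x = 2j` and `y` to `x = μj` and a lower budget `μ(y + j)`. Their sum is
`μ 4^V 2j = 2^(2V+1) · μj`, so the new budget is `(2^(2V+1) - 1) x`, the exact price of `2V + 1`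
doubling passes. -/
theorem amp_pays {i μ : ℕ} (hi : BodySpec i) (hμ : 1 ≤ μ) (V : ℕ) :
    Pays (balance μ (pool (i + 1)) (7 + 2 * i)) 1 (amp i μ) (Clean i V)
      (Clean i (fastF (i + 1) V)) := by
  have ho : 7 + 2 * i ∉ pool (i + 1) := by
    rw [show 7 + 2 * i = 5 + 2 * (i + 1) by ring]; exact budget_notMem_pool _
  have h1 : Pays (balance μ (pool (i + 1)) (7 + 2 * i)) 1
      (step 2 μ 0 1 2 3 (7 + 2 * i) (5 + 2 * i)) (Clean i V) (fun α => 1 ≤ α 0 ∧ α 1 = 0 ∧ α 2 = 0 ∧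
        α 3 = 0 ∧ α 4 = V ∧ (∀ k < i, α (5 + 2 * k) = 0) ∧ (∀ k ≤ i, α (6 + 2 * k) = 0) ∧
        α 0 + α (5 + 2 * i) = 2 ^ (2 * V + 1) * α 0) := by
    refine step_pays (by norm_num) hμ (by decide) (le_three_mem_pool (by norm_num))
      (le_three_mem_pool (by norm_num)) (le_three_mem_pool (by norm_num))
      (le_three_mem_pool (by norm_num)) (budget_mem_pool (by omega)) ho
      (by omega) (by omega) (by omega) ?_
    intro α β hf hα h0 h
    -- The complete pass shows that the lower budgets were empty, which discharges the condition in
    -- `Clean`.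
    obtain ⟨hα, hv⟩ := hα fun k hk => h0 _ (budget_mem_pool (by omega)) (by omega) (by omega)
      (by omega) (by omega)
    obtain ⟨j, a0, b0, b1, hz⟩ := h hα.two hα.three
    have hp := hα.pos
    have hs := hα.sum
    have hj : 1 ≤ μ * j := Nat.mul_pos hμ (by omega)
    refine ⟨by omega, hz 1 (le_three_mem_pool (by norm_num)) (by omega) (by omega),
      hz 2 (le_three_mem_pool (by norm_num)) (by omega) (by omega),
      hz 3 (le_three_mem_pool (by norm_num)) (by omega) (by omega), ?_, fun k hk => ?_,
      fun k hk => ?_, ?_⟩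
    · rw [hf 4 (by simp; omega), hα.four]
    · exact hz _ (budget_mem_pool (by omega)) (by omega) (by omega)
    · rw [hf _ (by simp; omega), hv k hk]
    · rw [b0, b1]
      rw [a0] at hs
      have : 2 ^ (2 * V + 1) * (μ * j) = μ * (4 ^ V * (2 * j)) := by
        rw [pow_succ, pow_mul]; norm_num; ring
      rw [this, ← hs]
      norm_num; ring
  have h2 : Pays (balance μ (pool (i + 1)) (7 + 2 * i)) 0 (ampBody i) (fun α => 1 ≤ α 0 ∧ α 1 = 0 ∧
      α 2 = 0 ∧ α 3 = 0 ∧ α 4 = V ∧ (∀ k < i, α (5 + 2 * k) = 0) ∧ (∀ k ≤ i, α (6 + 2 * k) = 0) ∧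
      α 0 + α (5 + 2 * i) = 2 ^ (2 * V + 1) * α 0) (Clean i (fastF (i + 1) V)) := by
    refine Pays.of_eq fun α β h => ⟨balance_congr (h.frame (by rw [counters_ampBody]; simp))
      (total_ampBody h), ?_⟩
    rintro ⟨a, b, c, d, e, f, g, k⟩
    exact hi V α β h a b c d e f g k
  simpa [amp] using h1.seq h2

/-- With an empty budget the balance is minus a geometric sum times a positive content, so it is
nonnegative only if no pass is outstanding. -/
theorem budget_exhausted {μ : ℕ} {Z : Finset ℕ} {o R : ℕ} {β : Config}
    (h : 0 ≤ balance μ Z o R β) (ho : β o = 0) (hZ : 1 ≤ total Z β) :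
    R = 0 ∧ balance μ Z o R β = 0 := by
  have hR : R = 0 := by
    by_contra hR
    rw [balance, ho] at h
    have h2 := Finset.single_le_sum (f := fun i => (μ : ℤ) ^ i) (fun i _ => by positivity)
      (Finset.mem_range.2 (Nat.pos_of_ne_zero hR))
    zify at hZ
    push_cast at h
    simp only [pow_zero] at h2
    nlinarith
  refine ⟨hR, ?_⟩
  rw [balance, ho, hR]; simp

theorem balance_two_congr {Z : Finset ℕ} {o c : ℕ} (hc : c ∉ Z) (ho : o ≠ c) {α β : Config}
    (h : ∀ z, z ≠ c → β z = α z) (R : ℕ) : balance 2 Z o R β = balance 2 Z o R α :=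
  balance_congr (h o ho) (total_congr fun z hz => h z fun h => hc (h ▸ hz)) R

/-! ### Soundness of the amplifiers, by induction on the level -/

theorem fastF_zero_iterate (m n : ℕ) : (fastF 0)^[m] n = n + m := by
  induction m with
  | zero => rfl
  | succ m ih => rw [Function.iterate_succ_apply', ih]; rfl

theorem fastF_one (n : ℕ) : fastF 1 n = 2 * n + 1 := by
  change (fastF 0)^[n + 1] n = _
  rw [fastF_zero_iterate]; ring

theorem bodySpec_zero : BodySpec 0 := by
  intro V α β h a0 a1 a2 a3 a4 _ av ab
  have hT := total_ampBody h
  obtain ⟨ρ, h1, τ, h2, h3⟩ := h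
  obtain ⟨m, e1⟩ := run_move h1
  have v4 := DFunLike.congr_fun e1 4
  have v6 := DFunLike.congr_fun e1 6
  have hv6 := av 0 le_rfl
  have hρ : ∀ z, z ≠ 4 → z ≠ 6 → ρ z = α z := fun z h4 h6 =>
    Run.frame h1 (by simp [counters, h4, h6])
  simp at v4 v6 hv6
  have hstep : ∀ i, Pays (balance 2 (pool 0) 5) 2 (seq (incr 5) (incr 5))
      (Ratio (2 * i) (V - m + 2 * i)) (Ratio (2 * (i + 1)) (V - m + 2 * (i + 1))) := fun i =>
    (incr_pays 0 (2 * i) (V - m + 2 * i)).seq (incr_pays 0 (2 * i + 1) (V - m + 2 * i + 1))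
  obtain ⟨q, hq, hQ⟩ := Pays.loop_dec (P := fun i => Ratio (2 * i) (V - m + 2 * i)) hstep
    (by simp [counters, counters_incr]) (fun α β h R => balance_two_congr
      (even_notMem_pool rfl (by norm_num)) (by norm_num) h R)
    (fun i α β h hα => hα.congr fun z hz => h z (by omega)) h2
  have hlast := incr_pays 0 (2 * q) (V - m + 2 * q) _ _ h3
  have hβ6 : β 6 = τ 6 := h3.frame (by simp [counters_incr])
  intro hb
  have hb0 : β 5 = 0 := hb 0 le_rfl
  -- `R` is the number of passes, out of the `2V + 1` paid for, that the run omits.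
  obtain ⟨R, hR⟩ : ∃ R, R + 1 + 2 * q = 2 * V + 1 := ⟨2 * V - 2 * q, by omega⟩
  obtain ⟨c1, c2⟩ := hQ (R + 1)
  obtain ⟨d1, d2⟩ := hlast R
  have hstart : balance 2 (pool 0) 5 (R + 1 + 2 * q) ρ = 0 := by
    rw [balance_two_eq, hR, total_pool_zero, hρ 0, hρ 1, hρ 2, hρ 3, hρ 5, a1, a2, a3] <;>
      try norm_num
    zify at ab
    linarith
  have htot : 1 ≤ total (pool 0) β := by
    have := le_total (le_three_mem_pool (i := 0) (c := 0) (by norm_num)) α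
    rw [total_pool_succ, total_pool_succ] at hT
    simp only [mul_zero, add_zero] at hT
    omega
  simp only [mul_zero, add_zero] at d1 d2
  obtain ⟨f1, f2⟩ := budget_exhausted (μ := 2) (R := R) (by omega) hb0 htot
  -- From `R = 0` and `q ≤ m ≤ V`: the empty budget also certifies that the exponent was copied to
  -- the control completely.
  have hVq : q = V ∧ m = V := by omega
  obtain ⟨rfl, rfl⟩ := hVq
  have hr := d2 (by omega) (c2 (by omega) ?_)
  · rw [fastF_one]
    refine ⟨by simpa using hr, fun k hk => ?_⟩
    obtain rfl : k = 0 := by omega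
    simp only [mul_zero, add_zero]
    omega
  · refine ⟨by rw [hρ 0] <;> simp [a0], ?_, by rw [hρ 2] <;> simp [a2], by rw [hρ 3] <;> simp [a3],
      by omega⟩
    rw [hρ 0, hρ 1, a1] <;> simp

/-- If `m ≤ V` units of the exponent are copied, the controls allow at most `m` increments and `m +
1` amplifiers. The budget needs `2V + 1` passes, so both bounds are attained with `m = V`. -/
theorem bodySpec_succ {i : ℕ} (hi : BodySpec i) : BodySpec (i + 1) := by
  intro V α β h a0 a1 a2 a3 a4 ay av ab
  have hT := total_ampBody h
  rw [ampBody_succ] at h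
  obtain ⟨ρ, h1, ρ', h1', τ, h2, h3⟩ := h
  obtain ⟨m, e1⟩ := (((replaces_inc 6).seq_inc (8 + 2 * i)).seq_dec 4).loop_eq h1
  have v4 := DFunLike.congr_fun e1 4
  have v6 := DFunLike.congr_fun e1 6
  have v8 := DFunLike.congr_fun e1 (8 + 2 * i)
  have hv6 := av 0 (Nat.zero_le _)
  have hv8 := av (i + 1) le_rfl
  rw [show 6 + 2 * (i + 1) = 8 + 2 * i by ring] at hv8
  rw [show 5 + 2 * (i + 1) = 7 + 2 * i by ring] at ab
  have hρ : ∀ z, z ≠ 4 → z ≠ 6 → z ≠ 8 + 2 * i → ρ' z = α z := fun z h4 h6 h8 => by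
    rw [Run.frame h1' (by simp [counters, h8]), Run.frame h1 (by simp [counters, h4, h6, h8])]
  have w4 : ρ' 4 = ρ 4 := Run.frame h1' (by simp [counters]; omega)
  have w6 : ρ' 6 = ρ 6 := Run.frame h1' (by simp [counters]; omega)
  have w8 := h1'.2
  have n1 : 8 + 2 * i ≠ 4 := by omega
  have n2 : 8 + 2 * i ≠ 6 := by omega
  simp [n1, n2, n1.symm, n2.symm] at v4 v6 v8 hv6
  set Φ := balance 2 (pool (i + 1)) (7 + 2 * i) with hΦ
  have hΦ' : Φ = balance 2 (pool (i + 1)) (5 + 2 * (i + 1)) := by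
    rw [hΦ, show 5 + 2 * (i + 1) = 7 + 2 * i by ring]
  have hc : 8 + 2 * i ∉ pool (i + 1) := even_notMem_pool (by omega) (by omega)
  obtain ⟨q, hq, hQ⟩ := Pays.loop_dec (Φ := Φ) (k := 1) (P := fun i => Ratio i (V - m + i))
    (fun j => by
      have := incr_pays (i + 1) j (V - m + j)
      rwa [← hΦ', show 5 + 2 * (i + 1) = 7 + 2 * i by ring] at this)
    (by simp [counters_incr]; omega)
    (fun α β h R => balance_two_congr (even_notMem_pool rfl (by norm_num)) (by omega) h R)
    (fun i α β h hα => hα.congr fun z hz => h z (by omega)) h2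
  obtain ⟨q', hq', hQ'⟩ := Pays.loop_dec (Φ := Φ) (k := 1)
    (P := fun j => Clean i ((fastF (i + 1))^[j] V))
    (fun j => by
      have := amp_pays hi one_le_two ((fastF (i + 1))^[j] V)
      rwa [← Function.iterate_succ_apply' (fastF (i + 1))] at this)
    (by simp [counters_amp])
    (fun α β h R => balance_two_congr hc (by omega) h R)
    (fun j α β h hα hb => by
      obtain ⟨h1, h2⟩ := hα fun k hk => by rw [← hb k hk]; exact (h _ (by omega)).symm
      exact ⟨h1.congr fun z hz => h z (by omega), fun k hk => by rw [h _ (by omega), h2 k hk]⟩) h3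
  intro hb
  have hb0 : β (7 + 2 * i) = 0 := by
    rw [show 7 + 2 * i = 5 + 2 * (i + 1) by ring]; exact hb _ le_rfl
  have f4 : τ (8 + 2 * i) = ρ' (8 + 2 * i) :=
    Run.frame h2 (by simp [counters, counters_incr]; omega)
  obtain ⟨R, hR⟩ : ∃ R, R + 1 * q' + 1 * q = 2 * V + 1 := ⟨2 * V + 1 - q - q', by omega⟩
  obtain ⟨c1, c2⟩ := hQ (R + 1 * q')
  obtain ⟨d1, d2⟩ := hQ' R
  have hTα : total (pool (i + 1)) ρ' = α 0 := by
    have : total (pool (i + 1)) ρ' = total (pool (i + 1)) α := total_congr fun z hz => by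
      rw [mem_pool] at hz
      exact hρ z (by grind) (by grind) (by grind)
    rw [this, total, Finset.sum_eq_single 0]
    · intro z hz h0
      rw [mem_pool] at hz
      rcases hz with hz | ⟨k, hk, rfl⟩
      · interval_cases z <;> simp_all
      · exact ay k hk
    · intro h; exact absurd (le_three_mem_pool (by norm_num)) h
  have hstart : Φ (R + 1 * q' + 1 * q) ρ' = 0 := by
    rw [hΦ, balance_two_eq, hR, hTα, hρ _ (by omega) (by omega) (by omega)]
    zify at ab
    linarith
  -- Content is conserved and the budget is empty, so the content of the pool at the end is at least
  -- `α 0`.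
  have htot : 1 ≤ total (pool (i + 1)) β := by
    have := le_total (le_three_mem_pool (i := i + 1 + 1) (c := 0) (by norm_num)) α
    rw [total_pool_succ (i + 1) β, show 5 + 2 * (i + 1) = 7 + 2 * i by ring, hb0] at hT
    omega
  obtain ⟨f1, f2⟩ := budget_exhausted (μ := 2) (R := R) (show 0 ≤ Φ R β by omega) hb0 htot
  have f2 : Φ R β = 0 := f2
  have hVq : q = V ∧ m = V ∧ q' = V + 1 := by omega
  obtain ⟨rfl, rfl, rfl⟩ := hVq
  have hr1 := c2 (by omega) ?_
  · have hv : ∀ k ≤ i, τ (6 + 2 * k) = 0 := fun k hk => by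
      by_cases hk0 : k = 0
      · subst hk0; simp only [mul_zero, add_zero]; omega
      · rw [Run.frame h2 (by simp [counters, counters_incr]; omega), hρ _ (by omega) (by omega)
          (by omega)]
        exact av k (by omega)
    obtain ⟨g1, g2⟩ := d2 (by omega) (fun _ => ⟨by simpa using hr1, hv⟩)
      fun k hk => hb k (by omega)
    refine ⟨g1, fun k hk => ?_⟩
    rcases Nat.lt_or_ge k (i + 1) with hk' | hk'
    · exact g2 k (by omega)
    · obtain rfl : k = i + 1 := by omega
      rw [show 6 + 2 * (i + 1) = 8 + 2 * i by ring]
      omega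
  · refine ⟨by rw [hρ 0] <;> first | exact a0 | omega, ?_, ?_, ?_, by omega⟩
    · rw [hρ 0, hρ 1, a1] <;> omega
    · rw [hρ 2] <;> first | exact a2 | omega
    · rw [hρ 3] <;> first | exact a3 | omega

theorem bodySpec (i : ℕ) : BodySpec i := by
  induction i with
  | zero => exact bodySpec_zero
  | succ i ih => exact bodySpec_succ ih

/-! ### Complete runs of the amplifiers -/

theorem testFree_incs {c m : ℕ} {P : Program} (h : P.TestFree) : (incs c m P).TestFree := by
  induction m with
  | zero => exact h
  | succ m ih => exact ⟨trivial, ih⟩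

theorem testFree_decs {c m : ℕ} {P : Program} (h : P.TestFree) : (decs c m P).TestFree := by
  induction m with
  | zero => exact h
  | succ m ih => exact ⟨trivial, ih⟩

theorem testFree_move (c c' : ℕ) : (move c c').TestFree := ⟨trivial, trivial⟩

theorem testFree_paidMove (μ o c c' : ℕ) : (paidMove μ o c c').TestFree :=
  ⟨trivial, trivial, testFree_incs trivial⟩

theorem testFree_step (a μ x y x' y' o t : ℕ) : (step a μ x y x' y' o t).TestFree :=
  ⟨testFree_decs (testFree_incs trivial), testFree_move _ _, testFree_paidMove _ _ _ _,
    testFree_paidMove _ _ _ _⟩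

theorem testFree_incr (o : ℕ) : (incr o).TestFree := ⟨testFree_step _ _ _ _ _ _ _ _, trivial⟩

theorem testFree_ampBody (i : ℕ) : (ampBody i).TestFree := by
  induction i with
  | zero =>
    exact ⟨⟨trivial, trivial⟩, ⟨trivial, testFree_incr _, testFree_incr _⟩, testFree_incr _⟩
  | succ i ih =>
    exact ⟨⟨trivial, trivial, trivial⟩, trivial, ⟨trivial, testFree_incr _⟩, trivial,
      testFree_step _ _ _ _ _ _ _ _, ih⟩

theorem testFree_amp (i μ : ℕ) : (amp i μ).TestFree :=
  ⟨testFree_step _ _ _ _ _ _ _ _, testFree_ampBody i⟩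

theorem Run.seq {M N : Program} {α β γ : Config} (h : M.Run α β) (h' : N.Run β γ) :
    (M.seq N).Run α γ := ⟨β, h, h'⟩

theorem run_loop_head {M : Program} {α β γ : Config} (h : M.Run α β) (h' : (loop M).Run β γ) :
    (loop M).Run α γ := Relation.ReflTransGen.head h h'

theorem run_loop_refl (M : Program) (α : Config) : (loop M).Run α α := Relation.ReflTransGen.refl

theorem run_dec_single (c m : ℕ) (γ : Config) :
    (dec c).Run (γ + single c (m + 1)) (γ + single c m) := by
  rw [run_dec, single_add, add_assoc]

/-- The budget equals the content `a * i + m`, of which `i` units pay for the transfer from `x'` and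
the rest for that from `y'`. -/
theorem step_run {a μ : ℕ} (ha : 1 ≤ a) (hμ : 1 ≤ μ) (x y x' y' o t i m : ℕ) :
    (step a μ x y x' y' o t).Run (single x (a * i) + single y m + single o (a * i + m))
      (single x (μ * i) + single t (μ * (m + (a - 1) * i))) := by
  have e : a * i + m = i + (m + (a - 1) * i) := by
    obtain ⟨a, rfl⟩ : ∃ b, a = b + 1 := ⟨a - 1, by omega⟩
    simp; ring
  have h1 := (divide_replaces a x x' y').loop_run i (single y m + single o (a * i + m))
  have h2 := move_run y y' m (single x' i + single y' ((a - 1) * i) + single o (a * i + m))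
  have h3 := paidMove_run hμ o x' x i (single y' (m + (a - 1) * i) + single o (m + (a - 1) * i))
  have h4 := paidMove_run hμ o y' t (m + (a - 1) * i) (single x (μ * i))
  refine Run.seq (β := single x' i + single y' ((a - 1) * i) + single o (a * i + m) + single y m)
    ?_ (Run.seq h2 (Run.seq (β := single x (μ * i) + single o (m + (a - 1) * i)
      + single y' (m + (a - 1) * i)) ?_ h4))
  · convert h1 using 1
    · simp only [smul_single, smul_eq_mul, mul_comm i a]; abel
    · simp only [smul_single, smul_eq_mul, mul_comm i (a - 1), smul_add, mul_one]; abel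
  · convert h3 using 1
    · simp only [e, single_add]; abel
    · abel

/-- The configuration with exponent `v` where `x` is `X`. -/
noncomputable def scaled (v X : ℕ) : Config := single 0 X + single 1 ((4 ^ v - 1) * X) + single 4 v

theorem exists_pow_eq_succ {b : ℕ} (hb : 1 ≤ b) (v : ℕ) : ∃ k, b ^ v = k + 1 :=
  ⟨b ^ v - 1, by have := Nat.one_le_pow v b hb; omega⟩

theorem incr_run (o v h : ℕ) : (incr o).Run (scaled v (4 * h) + single o (4 ^ v * (4 * h)))
    (scaled (v + 1) (2 * h)) := by
  have e : 4 * h + (4 ^ v - 1) * (4 * h) = 4 ^ v * (4 * h) := by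
    obtain ⟨k, hk⟩ : ∃ k, 4 ^ v = k + 1 := exists_pow_eq_succ (by norm_num) v
    rw [hk]; simp; ring
  have e' : 2 * ((4 ^ v - 1) * (4 * h) + (4 - 1) * h) = (4 ^ (v + 1) - 1) * (2 * h) := by
    obtain ⟨k, hk⟩ : ∃ k, 4 ^ v = k + 1 := exists_pow_eq_succ (by norm_num) v
    rw [pow_succ, hk, show (k + 1) * 4 - 1 = 4 * k + 3 by omega]
    simp; ring
  have h1 := step_run (a := 4) (μ := 2) (by norm_num) (by norm_num) 0 1 2 3 o 1 h
    ((4 ^ v - 1) * (4 * h))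
  rw [e, e'] at h1
  refine Run.seq (h1.of_add (testFree_step _ _ _ _ _ _ _ _) (single 4 v) ?_ rfl) ?_
  · rw [scaled]; abel
  · rw [run_inc, scaled, single_add]; abel

/-- An increment halves `x`. Evenness of the final value makes the initial value divisible by `4`,
so increments can be chained backwards. -/
theorem incr_run' (o v : ℕ) {z : ℕ} (hz : 2 ∣ z) (γ : Config) :
    (incr o).Run (scaled v (2 * z) + single o (4 ^ v * (2 * z)) + γ) (scaled (v + 1) z + γ) := by
  obtain ⟨h, rfl⟩ := hz
  have := (incr_run o v h).add_right (testFree_incr _) γ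
  rwa [show 4 * h = 2 * (2 * h) by ring] at this

/-- Repeating the increments as often as the control `c` allows. -/
theorem loop_incr_run (o c v q : ℕ) {z : ℕ} (hz : 2 ∣ z) :
    (loop (seq (dec c) (incr o))).Run
      (scaled v (2 ^ q * z) + single o ((2 ^ q - 1) * (4 ^ v * (2 ^ q * z))) + single c q)
      (scaled (v + q) z) := by
  induction q generalizing v with
  | zero => simpa using run_loop_refl _ _
  | succ q ih =>
    have h1 := run_dec_single c q (scaled v (2 ^ (q + 1) * z) +
      single o ((2 ^ (q + 1) - 1) * (4 ^ v * (2 ^ (q + 1) * z))))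
    have h2 := incr_run' o v (hz.mul_left (2 ^ q))
      (single o ((2 ^ q - 1) * (4 ^ (v + 1) * (2 ^ q * z))) + single c q)
    have h3 := ih (v + 1)
    refine run_loop_head (Run.seq h1 ?_) (by rwa [show v + (q + 1) = v + 1 + q by ring])
    convert h2 using 1
    · have e : (2 ^ (q + 1) - 1) * (4 ^ v * (2 ^ (q + 1) * z)) =
          4 ^ v * (2 * (2 ^ q * z)) + (2 ^ q - 1) * (4 ^ (v + 1) * (2 ^ q * z)) := by
        obtain ⟨k, hk⟩ : ∃ k, 2 ^ q = k + 1 := exists_pow_eq_succ (by norm_num) q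
        rw [pow_succ, pow_succ, hk, show (k + 1) * 2 - 1 = 2 * k + 1 by omega]
        simp; ring
      rw [e, single_add, show 2 ^ (q + 1) * z = 2 * (2 ^ q * z) by ring]; abel
    · abel

theorem double_incr_loop_run (o c v q : ℕ) {z : ℕ} (hz : 2 ∣ z) :
    (loop (seq (dec c) (seq (incr o) (incr o)))).Run
      (scaled v (2 ^ (2 * q) * z) + single o ((2 ^ (2 * q) - 1) * (4 ^ v * (2 ^ (2 * q) * z))) +
        single c q) (scaled (v + 2 * q) z) := by
  induction q generalizing v with
  | zero => simpa using run_loop_refl _ _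
  | succ q ih =>
    have h1 := run_dec_single c q (scaled v (2 ^ (2 * (q + 1)) * z) +
      single o ((2 ^ (2 * (q + 1)) - 1) * (4 ^ v * (2 ^ (2 * (q + 1)) * z))))
    have h2 := incr_run' o v (hz.mul_left (2 ^ (2 * q + 1)))
      (single o ((2 ^ (2 * q + 1) - 1) * (4 ^ (v + 1) * (2 ^ (2 * q + 1) * z))) + single c q)
    have h2' := incr_run' o (v + 1) (hz.mul_left (2 ^ (2 * q)))
      (single o ((2 ^ (2 * q) - 1) * (4 ^ (v + 1 + 1) * (2 ^ (2 * q) * z))) + single c q)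
    have h3 := ih (v + 1 + 1)
    obtain ⟨k, hk⟩ : ∃ k, 2 ^ (2 * q) = k + 1 := exists_pow_eq_succ (by norm_num) _
    have p1 : 2 ^ (2 * q + 1) = 2 * k + 2 := by rw [pow_succ, hk]; ring
    have p2 : 2 ^ (2 * (q + 1)) = 4 * k + 4 := by
      rw [show 2 * (q + 1) = 2 * q + 1 + 1 by ring, pow_succ, p1]; ring
    refine run_loop_head (Run.seq h1 (Run.seq ?_ h2'))
      (by rwa [show v + 2 * (q + 1) = v + 1 + 1 + 2 * q by ring, add_assoc] at *)
    convert h2 using 1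
    · rw [p1, p2, show 2 * ((2 * k + 2) * z) = (4 * k + 4) * z by ring]
      have e : (4 * k + 4 - 1) * (4 ^ v * ((4 * k + 4) * z)) = 4 ^ v * ((4 * k + 4) * z) +
          (2 * k + 2 - 1) * (4 ^ (v + 1) * ((2 * k + 2) * z)) := by
        rw [show 4 * k + 4 - 1 = 4 * k + 3 by omega, show 2 * k + 2 - 1 = 2 * k + 1 by omega]
        ring
      rw [e, single_add]; abel
    · rw [p1, hk, show 2 * ((k + 1) * z) = (2 * k + 2) * z by ring]
      have e : (2 * k + 2 - 1) * (4 ^ (v + 1) * ((2 * k + 2) * z)) =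
          4 ^ (v + 1) * ((2 * k + 2) * z) + (k + 1 - 1) * (4 ^ (v + 1 + 1) * ((k + 1) * z)) := by
        rw [show 2 * k + 2 - 1 = 2 * k + 1 by omega, show k + 1 - 1 = k by omega]
        ring
      rw [e, single_add]; abel

/-- Complete runs of `ampBody i`, with prescribed final value `z` of `x`. -/
def BodyRun (i : ℕ) : Prop := ∀ V z, 2 ∣ z → ∃ X, 2 ∣ X ∧
  2 ^ (2 * V + 1) * X = 4 ^ fastF (i + 1) V * z ∧
  (ampBody i).Run (single 0 X + single 4 V + single (5 + 2 * i) ((2 ^ (2 * V + 1) - 1) * X))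
    (scaled (fastF (i + 1) V) z)

theorem scaled_zero (X : ℕ) : scaled 0 X = single 0 X := by simp [scaled]

/-- The final value `z` is prescribed and the initial `X` solved for, since the divisions must be
exact. The equation for `X` expresses conservation of content, up to the factor `μ` of the first
pass. -/
theorem amp_run {i μ : ℕ} (hi : BodyRun i) (hμ : μ ∣ 2) (V z : ℕ) (hz : 2 ∣ z) :
    ∃ X, 2 ∣ X ∧ μ * (4 ^ V * X) = 4 ^ fastF (i + 1) V * z ∧
      (amp i μ).Run (scaled V X + single (7 + 2 * i) (4 ^ V * X)) (scaled (fastF (i + 1) V) z) := by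
  obtain ⟨X, hX, hXz, hr⟩ := hi V z hz
  -- The body starts with `x = μ * h`, so the halving pass before it has to start with `2 * h`.
  obtain ⟨h, rfl⟩ := hμ.trans hX
  have hμ1 : 1 ≤ μ := Nat.pos_of_dvd_of_pos hμ (by norm_num)
  have h1 := step_run (a := 2) (by norm_num) hμ1 0 1 2 3 (7 + 2 * i) (5 + 2 * i) h
    ((4 ^ V - 1) * (2 * h))
  have e2 : 2 ^ (2 * V + 1) = 2 * 4 ^ V := by rw [pow_succ, pow_mul, mul_comm]; norm_num
  refine ⟨2 * h, dvd_mul_right _ _, ?_, Run.seq (h1.of_add (testFree_step _ _ _ _ _ _ _ _)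
    (single 4 V) ?_ rfl) ?_⟩
  · rw [← hXz, e2]; ring
  · have e : 2 * h + (4 ^ V - 1) * (2 * h) = 4 ^ V * (2 * h) := by
      obtain ⟨k, hk⟩ := exists_pow_eq_succ (b := 4) (by norm_num) V
      rw [hk]; simp; ring
    rw [e, scaled]; abel
  · convert hr using 1
    have e : μ * ((4 ^ V - 1) * (2 * h) + (2 - 1) * h) = (2 ^ (2 * V + 1) - 1) * (μ * h) := by
      rw [e2]
      obtain ⟨k, hk⟩ := exists_pow_eq_succ (b := 4) (by norm_num) V
      rw [hk, show 2 * (k + 1) - 1 = 2 * k + 1 by omega]; simp; ring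
    rw [e]; abel

/-- Repeating an amplifier as often as the control `c` allows. -/
theorem loop_amp_run {i : ℕ} (hi : BodyRun i) (c q V z : ℕ) (hz : 2 ∣ z) :
    ∃ X, 2 ∣ X ∧ 2 ^ q * (4 ^ V * X) = 4 ^ (fastF (i + 1))^[q] V * z ∧
      (loop (seq (dec c) (amp i 2))).Run
        (scaled V X + single (7 + 2 * i) ((2 ^ q - 1) * (4 ^ V * X)) + single c q)
        (scaled ((fastF (i + 1))^[q] V) z) := by
  induction q generalizing V with
  | zero => exact ⟨z, hz, by simp, by simpa using run_loop_refl _ _⟩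
  | succ q ih =>
    obtain ⟨X', hX', e', r'⟩ := ih (fastF (i + 1) V)
    obtain ⟨X, hX, e, r⟩ := amp_run hi dvd_rfl V X' hX'
    rw [← Function.iterate_succ_apply] at e' r'
    refine ⟨X, hX, ?_, run_loop_head (Run.seq (run_dec_single c q _)
      (r.of_add (testFree_amp _ _) (single c q + single (7 + 2 * i)
        ((2 ^ q - 1) * (4 ^ fastF (i + 1) V * X'))) ?_ rfl)) ?_⟩
    · rw [← e', ← e]; ring
    · have : (2 ^ (q + 1) - 1) * (4 ^ V * X) =
          4 ^ V * X + (2 ^ q - 1) * (4 ^ fastF (i + 1) V * X') := by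
        obtain ⟨k, hk⟩ := exists_pow_eq_succ (b := 2) (by norm_num) q
        rw [← e, pow_succ, hk, show (k + 1) * 2 - 1 = 2 * k + 1 by omega]; simp; ring
      rw [this, single_add]; abel
    · convert r' using 1
      abel

theorem bodyRun_zero : BodyRun 0 := by
  intro V z hz
  -- There are `2V + 1` increments, each of which halves `x`.
  refine ⟨2 ^ (2 * V) * (2 * z), hz.mul_left _ |>.mul_left _, ?_, ?_⟩
  · rw [fastF_one, show (4 : ℕ) = 2 * 2 by norm_num, mul_pow, pow_succ]; ring
  · have h1 := move_run 4 6 V (single 0 (2 ^ (2 * V) * (2 * z)) +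
      single 5 ((2 ^ (2 * V + 1) - 1) * (2 ^ (2 * V) * (2 * z))))
    have h2 := (double_incr_loop_run 5 6 0 V (dvd_mul_right 2 z)).add_right
      (by exact ⟨trivial, testFree_incr _, testFree_incr _⟩) (single 5 (4 ^ (2 * V) * (2 * z)))
    have h3 := incr_run' 5 (2 * V) hz 0
    rw [scaled_zero, zero_add] at h2
    rw [add_zero, add_zero] at h3
    rw [fastF_one]
    refine Run.seq (β := single 0 (2 ^ (2 * V) * (2 * z)) +
      single 5 ((2 ^ (2 * V + 1) - 1) * (2 ^ (2 * V) * (2 * z))) + single 6 V) ?_ (Run.seq ?_ h3)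
    · convert h1 using 1
      · rfl
      · simp only [Nat.mul_zero, Nat.add_zero]
        abel
    · convert h2 using 1
      have : (2 ^ (2 * V + 1) - 1) * (2 ^ (2 * V) * (2 * z)) =
          (2 ^ (2 * V) - 1) * (4 ^ 0 * (2 ^ (2 * V) * (2 * z))) + 4 ^ (2 * V) * (2 * z) := by
        obtain ⟨k, hk⟩ := exists_pow_eq_succ (b := 2) (by norm_num) (2 * V)
        rw [show (4 : ℕ) = 2 * 2 by norm_num, mul_pow 2 2 (2 * V), pow_succ, hk,
          show (k + 1) * 2 - 1 = 2 * k + 1 by omega]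
        simp; ring
      rw [this, single_add]; abel

theorem bodyRun_succ {i : ℕ} (hi : BodyRun i) : BodyRun (i + 1) := by
  intro V z hz
  obtain ⟨X, hX, e, r⟩ := loop_amp_run hi (8 + 2 * i) (V + 1) V z hz
  have eF : fastF (i + 1 + 1) V = (fastF (i + 1))^[V + 1] V := rfl
  have e4 : 4 ^ V = 2 ^ V * 2 ^ V := by rw [← mul_pow]; norm_num
  rw [← eF] at e r
  -- The `V` increments that rebuild the exponent halve `x` down to the value `X` at which the
  -- amplifiers start.
  refine ⟨2 ^ V * X, hX.mul_left _, ?_, ?_⟩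
  · rw [← e, e4]; ring
  · rw [ampBody_succ]
    have h1 := (((replaces_inc 6).seq_inc (8 + 2 * i)).seq_dec 4).loop_run V
      (single 0 (2 ^ V * X) + single (7 + 2 * i) ((2 ^ (2 * V + 1) - 1) * (2 ^ V * X)))
    have h2 := (loop_incr_run (7 + 2 * i) 6 0 V hX).add_right (by exact ⟨trivial, testFree_incr _⟩)
      (single (7 + 2 * i) ((2 ^ (V + 1) - 1) * (4 ^ V * X)) + single (8 + 2 * i) (V + 1))
    rw [scaled_zero, zero_add] at h2
    refine Run.seq (β := single 0 (2 ^ V * X) + single (7 + 2 * i)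
      ((2 ^ (2 * V + 1) - 1) * (2 ^ V * X)) + single (8 + 2 * i) V + single 6 V) ?_
      (Run.seq (run_inc.2 rfl) (Run.seq ?_ (by rwa [add_assoc] at r)))
    · convert h1 using 1
      · simp only [smul_single, smul_eq_mul, mul_one, zero_add,
          show 5 + 2 * (i + 1) = 7 + 2 * i by ring]
        abel
      · simp only [smul_add, smul_single, smul_eq_mul, mul_one]
        abel
    · convert h2 using 1
      have : (2 ^ (2 * V + 1) - 1) * (2 ^ V * X) =
          (2 ^ V - 1) * (4 ^ 0 * (2 ^ V * X)) + (2 ^ (V + 1) - 1) * (4 ^ V * X) := by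
        obtain ⟨k, hk⟩ := exists_pow_eq_succ (b := 2) (by norm_num) V
        rw [e4, pow_succ, two_mul, pow_add, pow_succ, hk,
          show (k + 1) * 2 - 1 = 2 * k + 1 by omega,
          show (k + 1) * (k + 1) * 2 - 1 = 2 * k * k + 4 * k + 1 by
            rw [show (k + 1) * (k + 1) * 2 = 2 * k * k + 4 * k + 1 + 1 by ring]; rfl]
        simp; ring
      rw [this, single_add, single_add (8 + 2 * i)]; abel

theorem bodyRun (i : ℕ) : BodyRun i := by
  induction i with
  | zero => exact bodyRun_zero
  | succ i ih => exact bodyRun_succ ih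

/-! ### From exponents to powers -/

/-- Double the counter `6`, using `7`. -/
def double : Program := seq (loop (seq (dec 6) (seq (inc 7) (inc 7)))) (move 7 6)

/-- Double the ratio between the counters `3`, `0` and the power in `6`. -/
def expoStep (μ : ℕ) : Program :=
  seq (step 2 μ 0 3 2 5 1 3) (seq double (step 1 μ 0 3 2 5 1 3))

/-- Compute the power of two of the counter `4` in the counter `6`. -/
def expo (μ : ℕ) : Program := seq (inc 6) (loop (seq (dec 4) (expoStep μ)))

/-- Replace the content of `0`, `3` by a multiple of the ratio given by `6`, in `2`, `5`. -/
def settle : Program :=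
  seq (dec 6)
    (seq (loop (seq (dec 0) (seq (inc 2) (seq (inc 5)
      (seq (loop (seq (dec 6) (seq (dec 3) (seq (inc 7) (inc 5))))) (move 7 6))))))
    (seq (loop (seq (dec 0) (seq (loop (seq (dec 6) (seq (dec 3) (inc 7)))) (move 7 6))))
      (inc 6)))

theorem counters_expo (μ : ℕ) : (expo μ).counters = Finset.range 8 := by
  simp only [expo, expoStep, counters, counters_step (show 1 ≤ 2 by norm_num),
    counters_step le_rfl, double, counters_move]
  decide

theorem counters_settle : settle.counters = {0, 2, 3, 5, 6, 7} := by decide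

theorem testFree_double : double.TestFree := ⟨⟨trivial, trivial, trivial⟩, trivial, trivial⟩

theorem testFree_expoStep (μ : ℕ) : (expoStep μ).TestFree :=
  ⟨testFree_step _ _ _ _ _ _ _ _, testFree_double, testFree_step _ _ _ _ _ _ _ _⟩

theorem testFree_expo (μ : ℕ) : (expo μ).TestFree := ⟨trivial, trivial, testFree_expoStep μ⟩

theorem testFree_settle : settle.TestFree := by
  simp [settle, TestFree, move]

/-- Counters `0`, `3` have ratio `2 ^ i - 1`, and the power in `6` is at most `2 ^ i`. -/
structure PowRatio (i : ℕ) (α : Config) : Prop where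
  pos : 1 ≤ α 0
  sum : α 0 + α 3 = 2 ^ i * α 0
  two : α 2 = 0
  five : α 5 = 0
  pow : α 6 + α 7 ≤ 2 ^ i

def expoPool : Finset ℕ := {0, 2, 3, 5}

/-! ### Soundness of the final part -/

theorem run_double {α β : Config} (h : double.Run α β) :
    β 6 + β 7 ≤ 2 * (α 6 + α 7) ∧ ∀ z, z ≠ 6 → z ≠ 7 → β z = α z := by
  refine ⟨?_, fun z h6 h7 => h.frame (by simp [double, counters, counters_move, h6, h7])⟩
  obtain ⟨ρ, h1, h2⟩ := h
  obtain ⟨i, e1⟩ := (((replaces_inc 7).seq_inc 7).seq_dec 6).loop_eq h1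
  obtain ⟨j, e2⟩ := run_move h2
  have a6 := DFunLike.congr_fun e1 6
  have a7 := DFunLike.congr_fun e1 7
  have b6 := DFunLike.congr_fun e2 6
  have b7 := DFunLike.congr_fun e2 7
  simp at a6 a7 b6 b7
  omega

/-- The pass with `a = 2` doubles the ratio; the one with `a = 1` leaves it alone and serves only to
spend. Two passes per unit of the exponent match the available budget, as `4^V - 1` is the sum of
`2^i` over `i < 2V`. -/
theorem expoStep_pays {μ : ℕ} (hμ : 1 ≤ μ) (i : ℕ) :
    Pays (balance μ expoPool 1) 2 (expoStep μ) (PowRatio i) (PowRatio (i + 1)) := by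
  have hstep : ∀ {a : ℕ} {P Q : Config → Prop} (ha : 1 ≤ a),
      (∀ α β : Config, β 6 = α 6 → β 7 = α 7 → P α →
      (α 2 = 0 → α 5 = 0 → ∃ i, α 0 = a * i ∧ β 0 = μ * i ∧ β 3 = μ * (α 3 + (a - 1) * i) ∧
          β 2 = 0 ∧ β 5 = 0) → Q β) →
      Pays (balance μ expoPool 1) 1 (step a μ 0 3 2 5 1 3) P Q := by
    intro a P Q ha h
    refine step_pays ha hμ (by decide) (by decide) (by decide) (by decide) (by decide)
      (by decide) (by decide) (by decide) (by decide) (by decide) ?_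
    intro α β hf hα _ h'
    refine h α β (hf 6 (by decide)) (hf 7 (by decide)) hα fun a2 a5 => ?_
    obtain ⟨i, h1, h2, h3, h4⟩ := h' a2 a5
    exact ⟨i, h1, h2, h3, h4 2 (by decide) (by decide) (by decide),
      h4 5 (by decide) (by decide) (by decide)⟩
  have h1 : Pays (balance μ expoPool 1) 1 (step 2 μ 0 3 2 5 1 3) (PowRatio i)
      (fun α => 1 ≤ α 0 ∧ α 0 + α 3 = 2 ^ (i + 1) * α 0 ∧ α 2 = 0 ∧ α 5 = 0 ∧
        α 6 + α 7 ≤ 2 ^ i) := by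
    refine hstep (by norm_num) fun α β h6 h7 hα h => ?_
    obtain ⟨j, a0, b0, b3, b2, b5⟩ := h hα.two hα.five
    have hs := hα.sum
    have hp := hα.pos
    refine ⟨?_, ?_, b2, b5, by rw [h6, h7]; exact hα.pow⟩
    · rw [b0]; exact Nat.mul_pos hμ (by omega)
    · rw [b0, b3]
      rw [a0] at hs
      have : 2 ^ (i + 1) * (μ * j) = μ * (2 ^ i * (2 * j)) := by ring
      rw [this, ← hs]; norm_num; ring
  have h2 : Pays (balance μ expoPool 1) 0 double (fun α => 1 ≤ α 0 ∧ α 0 + α 3 = 2 ^ (i + 1) * α 0 ∧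
      α 2 = 0 ∧ α 5 = 0 ∧ α 6 + α 7 ≤ 2 ^ i) (PowRatio (i + 1)) := by
    refine Pays.of_eq fun α β h => ?_
    obtain ⟨h67, hf⟩ := run_double h
    refine ⟨balance_congr (hf 1 (by decide) (by decide)) (total_congr fun z hz => hf z ?_ ?_),
      fun ⟨a, b, c, d, e⟩ => ⟨?_, ?_, ?_, ?_, ?_⟩⟩
    · rintro rfl; revert hz; decide
    · rintro rfl; revert hz; decide
    · rwa [hf 0 (by decide) (by decide)]
    · rwa [hf 0 (by decide) (by decide), hf 3 (by decide) (by decide)]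
    · rwa [hf 2 (by decide) (by decide)]
    · rwa [hf 5 (by decide) (by decide)]
    · rw [pow_succ]; omega
  have h3 : Pays (balance μ expoPool 1) 1 (step 1 μ 0 3 2 5 1 3) (PowRatio (i + 1))
      (PowRatio (i + 1)) := by
    refine hstep le_rfl fun α β h6 h7 hα h => ?_
    obtain ⟨j, a0, b0, b3, b2, b5⟩ := h hα.two hα.five
    have hs := hα.sum
    have hp := hα.pos
    refine ⟨?_, ?_, b2, b5, by rw [h6, h7]; exact hα.pow⟩
    · rw [b0]; exact Nat.mul_pos hμ (by omega)
    · rw [b0, b3]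
      rw [a0] at hs
      have : 2 ^ (i + 1) * (μ * j) = μ * (2 ^ (i + 1) * (1 * j)) := by ring
      rw [this, ← hs]; norm_num; ring
  exact h1.seq (h2.seq h3)

/-- For general `μ` content is not conserved, but it never shrinks; this gives the positivity
required by `budget_exhausted`. -/
theorem expoStep_total {μ : ℕ} (hμ : 1 ≤ μ) {α β : Config} (h : (expoStep μ).Run α β) :
    total expoPool α ≤ total expoPool β := by
  have hstep : ∀ {a : ℕ} {α β : Config}, 1 ≤ a → (step a μ 0 3 2 5 1 3).Run α β →
      total expoPool α ≤ total expoPool β := by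
    intro a α β ha h
    obtain ⟨e, _, e2, _⟩ := step_sound (Z := expoPool) ha hμ (by decide) (by decide) (by decide)
      (by decide) (by decide) (by decide) (by decide) (by decide) (by decide) (by decide) h
    have := Nat.le_mul_of_pos_left e hμ
    omega
  obtain ⟨ρ, h1, τ, h2, h3⟩ := h
  have e : total expoPool τ = total expoPool ρ := total_congr fun z hz => by
    refine (run_double h2).2 z ?_ ?_ <;> (rintro rfl; revert hz; decide)
  exact (hstep (by norm_num) h1).trans (e ▸ hstep le_rfl h3)

theorem expo_sound {μ V : ℕ} (hμ : 1 ≤ μ) {α β : Config} (h : (expo μ).Run α β) (a0 : 1 ≤ α 0)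
    (a1 : α 1 = (∑ i ∈ Finset.range (2 * V), μ ^ i) * α 0) (a2 : α 2 = 0) (a3 : α 3 = 0)
    (a4 : α 4 = V) (a5 : α 5 = 0) (a6 : α 6 = 0) (a7 : α 7 = 0) (b1 : β 1 = 0) :
    β 4 = 0 ∧ PowRatio V β := by
  obtain ⟨ρ, h1, h2⟩ := h
  have hρ : ∀ z, z ≠ 6 → ρ z = α z := fun z hz => (h1.1 z hz).symm
  have htot : 1 ≤ total expoPool β := by
    have hle : total expoPool ρ ≤ total expoPool β := by
      rw [run_loop] at h2
      clear b1
      induction h2 with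
      | refl => exact le_rfl
      | tail _ h ih =>
        obtain ⟨σ, g1, g2⟩ := h
        refine (ih.trans_eq ?_).trans (expoStep_total hμ g2)
        exact (total_dec (by decide) g1).symm
    refine le_trans ?_ ((le_total (Z := expoPool) (z := 0) (by decide) ρ).trans hle)
    rwa [hρ 0 (by decide)]
  obtain ⟨q, hq, hQ⟩ := Pays.loop_dec (expoStep_pays hμ)
    (by rw [expoStep, counters, counters, counters_step (by norm_num),
          counters_step (by norm_num)]; decide)
    (fun α β h R => balance_congr (h 1 (by decide)) (total_congr fun z hz => h z
      (by rintro rfl; revert hz; decide)) R)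
    (fun i α β h hα => ⟨by rw [h 0 (by decide)]; exact hα.pos,
      by rw [h 0 (by decide), h 3 (by decide)]; exact hα.sum, by rw [h 2 (by decide)]; exact hα.two,
      by rw [h 5 (by decide)]; exact hα.five,
      by rw [h 6 (by decide), h 7 (by decide)]; exact hα.pow⟩) h2
  have r4 := hρ 4 (by decide)
  obtain ⟨R, hR⟩ : ∃ R, R + 2 * q = 2 * V := ⟨2 * V - 2 * q, by omega⟩
  obtain ⟨c1, c2⟩ := hQ R
  have hstart : balance μ expoPool 1 (R + 2 * q) ρ = 0 := by
    rw [balance, hR, show total expoPool ρ = ρ 0 + (ρ 2 + (ρ 3 + ρ 5)) from rfl,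
      hρ 0 (by decide), hρ 1 (by decide), hρ 2 (by decide), hρ 3 (by decide), hρ 5 (by decide),
      a1, a2, a3, a5]
    push_cast; ring
  obtain ⟨f1, f2⟩ := budget_exhausted (μ := μ) (R := R) (by omega) b1 htot
  obtain rfl : q = V := by omega
  refine ⟨by omega, c2 (by omega) ⟨by rwa [hρ 0 (by decide)], ?_, ?_, ?_, ?_⟩⟩
  · rw [hρ 0 (by decide), hρ 3 (by decide), a3]; simp
  · rwa [hρ 2 (by decide)]
  · rwa [hρ 5 (by decide)]
  · rw [h1.2, hρ 7 (by decide), a6, a7]; norm_num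

/-- Each unit of counter `0` allows at most `B` units to leave counter `3`, where `B + 1` is the
power actually computed. Counter `3` holds `K - 1` units per unit of counter `0`, so both can be
emptied only if `B + 1 = K` and every round is complete. -/
theorem settle_sound {K : ℕ} {α β : Config} (h : settle.Run α β) (a0 : 1 ≤ α 0)
    (hs : α 0 + α 3 = K * α 0) (a2 : α 2 = 0) (a5 : α 5 = 0) (a6 : α 6 + α 7 ≤ K) (b0 : β 0 = 0)
    (b3 : β 3 = 0) (b7 : β 7 = 0) : β 6 = K ∧ β 5 = K * β 2 := by
  obtain ⟨ρ, h1, τ, h2, σ, h3, h4⟩ := h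
  have hρ : ∀ z, z ≠ 6 → ρ z = α z := fun z hz => (h1.1 z hz).symm
  have hβ : ∀ z, z ≠ 6 → σ z = β z := fun z hz => h4.1 z hz
  have r6 := h1.2
  have s6 := h4.2
  set B := ρ 6 + ρ 7 with hB
  have r7 := hρ 7 (by decide)
  -- `D` is the shortfall of the computed power.
  obtain ⟨D, hD⟩ : ∃ D, K = B + 1 + D := ⟨K - (B + 1), by omega⟩
  -- Once counters `0` and `3` are empty, the two inequalities on counter `5` squeeze `D * α 0` to
  -- zero.
  have hinv2 : τ 6 + τ 7 = B ∧ D * α 0 + B * τ 0 + (B + 1) * τ 2 ≤ τ 3 + τ 5 ∧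
      τ 5 ≤ (B + 1) * τ 2 := by
    rw [run_loop] at h2
    clear h3
    induction h2 with
    | refl =>
      refine ⟨rfl, ?_, ?_⟩ <;>
      rw [hρ 2 (by decide), hρ 5 (by decide), a2, a5]
      · rw [hρ 0 (by decide), hρ 3 (by decide)]
        rw [hD] at hs; nlinarith
      · simp
    | @tail γ δ _ h ih =>
      obtain ⟨i1, i2, i3⟩ := ih
      obtain ⟨u, g1, v, g2, w, g3, y, g4, g5⟩ := h
      obtain ⟨e, e4⟩ := ((((replaces_inc 5).seq_inc 7).seq_dec 3).seq_dec 6).loop_eq g4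
      obtain ⟨j, e5⟩ := run_move g5
      rw [run_dec] at g1
      rw [run_inc] at g2 g3
      subst g1 g2 g3
      have V (z : ℕ) := And.intro (DFunLike.congr_fun e4 z) (DFunLike.congr_fun e5 z)
      have v0 := V 0
      have v2 := V 2
      have v3 := V 3
      have v5 := V 5
      have v6 := V 6
      have v7 := V 7
      simp at v0 v2 v3 v5 v6 v7 i1 i2 i3
      have hb : e ≤ B := by omega
      have w0 : δ 0 = u 0 := by omega
      have w2 : δ 2 = u 2 + 1 := by omega
      rw [w0, w2]
      clear_value B
      simp only [Nat.mul_add, Nat.add_mul, Nat.mul_one, Nat.one_mul] at i2 i3 ⊢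
      refine ⟨?_, ?_, ?_⟩ <;> omega
  have hinv3 : σ 6 + σ 7 = B ∧ D * α 0 + B * σ 0 + (B + 1) * σ 2 ≤ σ 3 + σ 5 ∧
      σ 5 ≤ (B + 1) * σ 2 := by
    rw [run_loop] at h3
    clear h4 hβ s6
    induction h3 with
    | refl => exact hinv2
    | @tail γ δ _ h ih =>
      obtain ⟨i1, i2, i3⟩ := ih
      obtain ⟨u, g1, y, g4, g5⟩ := h
      obtain ⟨e, e4⟩ := (((replaces_inc 7).seq_dec 3).seq_dec 6).loop_eq g4
      obtain ⟨j, e5⟩ := run_move g5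
      rw [run_dec] at g1
      subst g1
      have V (z : ℕ) := And.intro (DFunLike.congr_fun e4 z) (DFunLike.congr_fun e5 z)
      have v0 := V 0
      have v2 := V 2
      have v3 := V 3
      have v5 := V 5
      have v6 := V 6
      have v7 := V 7
      simp at v0 v2 v3 v5 v6 v7 i1 i2 i3
      have hb : e ≤ B := by omega
      have w0 : δ 0 = u 0 := by omega
      have w2 : δ 2 = u 2 := by omega
      rw [w0, w2]
      clear_value B
      simp only [Nat.mul_add, Nat.add_mul, Nat.mul_one, Nat.one_mul] at i2 i3 ⊢
      refine ⟨?_, ?_, ?_⟩ <;> omega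
  obtain ⟨i1, i2, i3⟩ := hinv3
  rw [hβ 0 (by decide), hβ 2 (by decide), hβ 3 (by decide), hβ 5 (by decide), b0, b3] at i2
  rw [hβ 2 (by decide), hβ 5 (by decide)] at i3
  rw [hβ 7 (by decide), b7] at i1
  have hD0 : D = 0 := by
    have : D * α 0 = 0 := by omega
    rcases mul_eq_zero.1 this with h | h
    · exact h
    · omega
  subst hD0
  rw [hD]
  constructor
  · omega
  · rw [Nat.add_zero]; omega

/-! ### Complete runs of the final part -/

/-- Here `γ` is a catalyst, restored by every round; in `settle` it is the content of counter `6`.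
-/
theorem loop_run_nsmul {M : Program} (hM : M.TestFree) {u w γ : Config}
    (h : M.Run (u + γ) (w + γ)) (i : ℕ) : (loop M).Run (i • u + γ) (i • w + γ) := by
  have key : ∀ j, (loop M).Run (i • u + γ + j • w) (γ + (i + j) • w) := by
    induction i with
    | zero => intro j; simpa using run_loop_refl _ _
    | succ i ih =>
      intro j
      refine run_loop_head (h.of_add hM (i • u + j • w) ?_ rfl) ?_
      · rw [succ_nsmul]; abel
      · have := ih (j + 1)
        rw [succ_nsmul, show i + (j + 1) = i + 1 + j by ring] at this
        convert this using 1
        abel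
  simpa [add_comm] using key 0

theorem double_run (m : ℕ) : double.Run (single 6 m) (single 6 (2 * m)) := by
  have h1 := (((replaces_inc 7).seq_inc 7).seq_dec 6).loop_run m 0
  have h2 := move_run 7 6 (2 * m) 0
  rw [zero_add, zero_add] at h2
  refine Run.seq ?_ h2
  convert h1 using 1
  · simp
  · simp [two_mul]

/-- Ratio `2 ^ i - 1` between the counters `3` and `0`, and power `2 ^ i` in `6`. -/
noncomputable def powered (i X : ℕ) : Config :=
  single 0 X + single 3 ((2 ^ i - 1) * X) + single 6 (2 ^ i)

theorem expoStep_run {μ : ℕ} (hμ : 1 ≤ μ) (i h : ℕ) : (expoStep μ).Run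
    (powered i (2 * h) + single 1 (2 ^ i * (2 * h) + μ * (2 ^ i * (2 * h))))
    (powered (i + 1) (μ * (μ * h))) := by
  obtain ⟨k, hk⟩ := exists_pow_eq_succ (b := 2) (by norm_num) i
  have h1 := step_run (a := 2) (by norm_num) hμ 0 3 2 5 1 3 h (k * (2 * h))
  have h2 := double_run (2 ^ i)
  have h3 := step_run (a := 1) le_rfl hμ 0 3 2 5 1 3 (μ * h) ((2 * k + 1) * (μ * h))
  refine Run.seq (h1.of_add (testFree_step _ _ _ _ _ _ _ _)
    (single 6 (2 ^ i) + single 1 (μ * (2 ^ i * (2 * h)))) ?_ rfl)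
    (Run.seq (h2.of_add testFree_double (single 0 (μ * h) +
      single 3 (μ * (k * (2 * h) + (2 - 1) * h)) + single 1 (μ * (2 ^ i * (2 * h)))) ?_ rfl)
      (h3.of_add (testFree_step _ _ _ _ _ _ _ _) (single 6 (2 * 2 ^ i)) ?_ ?_))
  · have e : 2 * h + k * (2 * h) = 2 ^ i * (2 * h) := by rw [hk]; ring
    rw [powered, e, single_add, hk, Nat.add_sub_cancel]; abel
  · abel
  · have e1 : μ * (k * (2 * h) + (2 - 1) * h) = (2 * k + 1) * (μ * h) := by simp; ring
    have e2 : μ * (2 ^ i * (2 * h)) = 1 * (μ * h) + (2 * k + 1) * (μ * h) := by rw [hk]; ring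
    rw [e1, e2, one_mul]; abel
  · rw [powered, show 2 ^ (i + 1) = 2 * 2 ^ i by ring,
      show 2 * 2 ^ i - 1 = 2 * k + 1 by rw [hk]; omega]
    congr 3
    simp; ring

theorem loop_expoStep_run {μ : ℕ} (hμ : 1 ≤ μ) (q i l : ℕ) :
    (loop (seq (dec 4) (expoStep μ))).Run (powered i (2 ^ q * l) +
      single 1 ((∑ j ∈ Finset.range (2 * q), μ ^ j) * (2 ^ i * (2 ^ q * l))) + single 4 q)
      (powered (i + q) (μ ^ (2 * q) * l)) := by
  induction q generalizing i l with
  | zero => simpa using run_loop_refl _ _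
  | succ q ih =>
    have h1 := run_dec_single 4 q (powered i (2 ^ (q + 1) * l) +
      single 1 ((∑ j ∈ Finset.range (2 * (q + 1)), μ ^ j) * (2 ^ i * (2 ^ (q + 1) * l))))
    have h2 := expoStep_run hμ i (2 ^ q * l)
    have h3 := ih (i + 1) (μ * μ * l)
    have e : (∑ j ∈ Finset.range (2 * (q + 1)), μ ^ j) * (2 ^ i * (2 ^ (q + 1) * l)) =
        2 ^ i * (2 * (2 ^ q * l)) + μ * (2 ^ i * (2 * (2 ^ q * l))) +
          (∑ j ∈ Finset.range (2 * q), μ ^ j) * (2 ^ (i + 1) * (2 ^ q * (μ * μ * l))) := by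
      rw [show 2 * (q + 1) = 2 * q + 1 + 1 by ring, geom_sum_succ, geom_sum_succ]; ring
    refine run_loop_head (Run.seq h1 (h2.of_add (testFree_expoStep _) (single 4 q +
      single 1 ((∑ j ∈ Finset.range (2 * q), μ ^ j) * (2 ^ (i + 1) * (2 ^ q * (μ * μ * l)))))
      ?_ rfl))
      ?_
    · rw [e, show 2 ^ (q + 1) * l = 2 * (2 ^ q * l) by ring, single_add]; abel
    · convert h3 using 1
      · rw [show μ * (μ * (2 ^ q * l)) = 2 ^ q * (μ * μ * l) by ring]; abel
      · rw [show i + (q + 1) = i + 1 + q by ring,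
          show μ ^ (2 * (q + 1)) * l = μ ^ (2 * q) * (μ * μ * l) by ring]

/-- The first loop converts `l` units and the second discards the other `r`; the freedom to discard
makes every value of the output `x` reachable. -/
theorem settle_run (k l r : ℕ) : settle.Run
    (single 0 (l + r) + single 3 (k * (l + r)) + single 6 (k + 1))
    (single 2 l + single 5 ((k + 1) * l) + single 6 (k + 1)) := by
  have hA : (seq (dec 0) (seq (inc 2) (seq (inc 5)
      (seq (loop (seq (dec 6) (seq (dec 3) (seq (inc 7) (inc 5))))) (move 7 6))))).Run
      (single 0 1 + single 3 k + single 6 k) (single 2 1 + single 5 (k + 1) + single 6 k) := by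
    have h1 := ((((replaces_inc 5).seq_inc 7).seq_dec 3).seq_dec 6).loop_run k
      (single 2 1 + single 5 1)
    have h2 := move_run 7 6 k (single 2 1 + single 5 (k + 1))
    refine Run.seq ((run_dec (β := single 3 k + single 6 k)).2 (by abel))
      (Run.seq (run_inc.2 rfl) (Run.seq (run_inc.2 rfl) (Run.seq ?_ h2)))
    convert h1 using 1
    · simp only [smul_add, smul_single, smul_eq_mul, mul_one, zero_add]; abel
    · simp only [smul_add, smul_single, smul_eq_mul, mul_one, single_add]; abel
  have hB : (seq (dec 0) (seq (loop (seq (dec 6) (seq (dec 3) (inc 7)))) (move 7 6))).Run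
      (single 0 1 + single 3 k + single 6 k) (0 + single 6 k) := by
    have h1 := (((replaces_inc 7).seq_dec 3).seq_dec 6).loop_run k 0
    have h2 := move_run 7 6 k 0
    refine Run.seq ((run_dec (β := single 3 k + single 6 k)).2 (by abel)) (Run.seq ?_ h2)
    convert h1 using 1
    · simp
    · simp
  have hA' := (loop_run_nsmul (by simp [TestFree, move]) hA l).add_right
    (by simp [TestFree, move]) (r • (single 0 1 + single 3 k))
  have hB' := (loop_run_nsmul (by simp [TestFree, move]) hB r).add_right
    (by simp [TestFree, move]) (l • (single 2 1 + single 5 (k + 1)))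
  refine Run.seq ((run_dec (β := single 0 (l + r) + single 3 (k * (l + r)) + single 6 k)).2 ?_)
    (Run.seq ?_ (Run.seq hB' (run_inc.2 ?_)))
  · rw [single_add 6]; abel
  · convert hA' using 1
    · rw [mul_comm k, Nat.add_mul]
      simp only [smul_add, smul_single, smul_eq_mul, mul_one, single_add]
      abel
    · abel
  · rw [mul_comm _ l]
    simp only [smul_add, smul_single, smul_eq_mul, mul_one, Nat.mul_add, single_add, smul_zero]
    abel

/-- Complete runs of the final part. -/
theorem expo_settle_run {μ : ℕ} (hμ : 1 ≤ μ) (V : ℕ) {l l' : ℕ} (hl : l ≤ l') :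
    (seq (expo μ) settle).Run (single 0 (2 ^ V * l') +
      single 1 ((∑ j ∈ Finset.range (2 * V), μ ^ j) * (2 ^ V * l')) + single 4 V)
      (single 2 l + single 5 (2 ^ V * l) + single 6 (2 ^ V)) := by
  obtain ⟨k, hk⟩ := exists_pow_eq_succ (b := 2) (by norm_num) V
  have h1 := loop_expoStep_run hμ V 0 l'
  obtain ⟨r, hr⟩ : ∃ r, μ ^ (2 * V) * l' = l + r :=
    ⟨μ ^ (2 * V) * l' - l, by
      have := Nat.le_mul_of_pos_left l' (Nat.pow_pos (n := 2 * V) hμ); omega⟩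
  have h2 := settle_run k l r
  rw [zero_add, hr, powered, powered, hk, Nat.add_sub_cancel, ← hk] at h1
  rw [← hk] at h2
  refine Run.seq (Run.seq (run_inc.2 rfl) ?_) h2
  convert h1 using 1
  simp; abel

theorem expo_settle_sound {μ V : ℕ} (hμ : 1 ≤ μ) {α β : Config}
    (h : (seq (expo μ) settle).Run α β) (a0 : 1 ≤ α 0)
    (a1 : α 1 = (∑ i ∈ Finset.range (2 * V), μ ^ i) * α 0) (a2 : α 2 = 0) (a3 : α 3 = 0)
    (a4 : α 4 = V) (a5 : α 5 = 0) (a6 : α 6 = 0) (a7 : α 7 = 0) (b0 : β 0 = 0) (b1 : β 1 = 0)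
    (b3 : β 3 = 0) (b7 : β 7 = 0) : β 4 = 0 ∧ β 6 = 2 ^ V ∧ β 5 = 2 ^ V * β 2 := by
  obtain ⟨ρ, h1, h2⟩ := h
  have e1 : β 1 = ρ 1 := h2.frame (by rw [counters_settle]; decide)
  have e4 : β 4 = ρ 4 := h2.frame (by rw [counters_settle]; decide)
  obtain ⟨r4, hr⟩ := expo_sound hμ h1 a0 a1 a2 a3 a4 a5 a6 a7 (by omega)
  exact ⟨by omega, settle_sound h2 hr.pos hr.sum hr.two hr.five hr.pow b0 b3 b7⟩

/-! ### The preamplifiers -/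

/-- Add `1`, `a`, `b` to the counters `0`, `1`, `o`. -/
def startBody (a b o : ℕ) : Program := incs 1 a (incs o b (inc 0))

/-- Put `v` to the exponent and equal multiples of `1`, `a`, `b` to the counters `0`, `1`, `o`. -/
def start (v a b o : ℕ) (P : Program) : Program :=
  incs 4 v (seq (startBody a b o) (seq (loop (startBody a b o)) P))

/-- `k` copies of the amplifier `amp i 1`, followed by `P`. -/
def amps (i : ℕ) : ℕ → Program → Program
  | 0, P => P
  | k + 1, P => seq (amp i 1) (amps i k P)

/-- The preamplifier for `d = e + 1`, without the tests. -/
def mainPart : ℕ → ℕ → Program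
  | 0, n => start (fastF 2 n) (2 * fastF 2 n) 0 0 (seq (expo 1) settle)
  | e + 1, n => start n (4 ^ n - 1) ((n + 2) * 4 ^ n) (9 + 2 * e)
      (amps (e + 1) (n + 1) (seq (step 1 1 0 1 2 3 (9 + 2 * e) 1) (seq (expo 2) settle)))

/-- The preamplifier for `d = e + 1`. -/
def preamp (e n : ℕ) : Program :=
  withTests (mainPart e n) (0 :: 1 :: 3 :: (List.range (e + 1)).map (fun k => 7 + 2 * k))

/-! ### Runs and counters of the preamplifiers -/

theorem run_tests {c : ℕ} {cs : List ℕ} {α β : Config} :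
    (tests c cs).Run α β ↔ β = α ∧ ∀ z ∈ c :: cs, α z = 0 := by
  induction cs generalizing c α with
  | nil => simp [tests, run_test]
  | cons c' cs ih =>
    simp only [tests, run_seq, run_test, ih]
    constructor
    · rintro ⟨ρ, ⟨rfl, h1⟩, rfl, h2⟩
      exact ⟨rfl, by simpa [h1] using h2⟩
    · rintro ⟨rfl, h⟩
      exact ⟨β, ⟨rfl, h c (by simp)⟩, rfl, fun z hz => h z (by simp_all)⟩

theorem run_withTests {M : Program} {c : ℕ} {cs : List ℕ} {α β : Config} :
    (withTests M (c :: cs)).Run α β ↔ M.Run α β ∧ ∀ z ∈ c :: cs, β z = 0 := by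
  simp only [withTests, run_seq, run_tests]
  constructor
  · rintro ⟨ρ, h1, rfl, h2⟩; exact ⟨h1, h2⟩
  · rintro ⟨h1, h2⟩; exact ⟨β, h1, rfl, h2⟩

theorem startBody_replaces (a b o : ℕ) :
    (startBody a b o).Replaces 0 (single 1 a + (single o b + single 0 1)) :=
  ((replaces_inc 0).incs o b).incs 1 a

/-- The copy of the body outside the loop guarantees `m ≥ 1`, that is, positive content. -/
theorem run_start {v a b o : ℕ} {P : Program} {β : Config} :
    (start v a b o P).Run 0 β ↔ ∃ m, 1 ≤ m ∧
      P.Run (single 4 v + single 1 (m * a) + single o (m * b) + single 0 m) β := by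
  have hB := startBody_replaces a b o
  rw [start, run_incs, run_seq, zero_add]
  constructor
  · rintro ⟨ρ, h1, τ, h2, h3⟩
    obtain ⟨γ, e1, rfl⟩ := (hB _ _).1 h1
    obtain ⟨i, e2⟩ := hB.loop_eq h2
    refine ⟨i + 1, by omega, ?_⟩
    convert h3 using 1
    rw [add_zero] at e1
    subst e1
    simp only [smul_zero, add_zero, smul_add, smul_single, smul_eq_mul, mul_one] at e2
    rw [e2, Nat.add_mul, Nat.add_mul, single_add, single_add, single_add, one_mul, one_mul]
    abel
  · rintro ⟨m, hm, h⟩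
    obtain ⟨i, rfl⟩ : ∃ i, m = i + 1 := ⟨m - 1, by omega⟩
    refine ⟨_, (hB _ _).2 ⟨single 4 v, (add_zero _).symm, rfl⟩, ?_⟩
    have h2 := hB.loop_run i (single 4 v + (single 1 a + (single o b + single 0 1)))
    rw [smul_zero, add_zero] at h2
    refine ⟨_, h2, ?_⟩
    convert h using 1
    simp only [smul_add, smul_single, smul_eq_mul, mul_one]
    rw [Nat.add_mul, Nat.add_mul, single_add, single_add, single_add, one_mul, one_mul]
    abel

theorem run_amps {i k V : ℕ} {P : Program} {α β : Config} (h : (amps i k P).Run α β) :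
    ∃ ρ, P.Run ρ β ∧ ∀ R, balance 1 (pool (i + 1)) (7 + 2 * i) (R + k) α ≤
        balance 1 (pool (i + 1)) (7 + 2 * i) R ρ ∧
      (balance 1 (pool (i + 1)) (7 + 2 * i) (R + k) α =
        balance 1 (pool (i + 1)) (7 + 2 * i) R ρ → Clean i V α →
          Clean i ((fastF (i + 1))^[k] V) ρ) := by
  induction k generalizing α V with
  | zero => exact ⟨α, h, fun R => by simp⟩
  | succ k ih =>
    obtain ⟨τ, h1, h2⟩ := h
    obtain ⟨ρ, hρ, hR⟩ := ih (V := fastF (i + 1) V) h2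
    refine ⟨ρ, hρ, fun R => ?_⟩
    obtain ⟨a1, a2⟩ := amp_pays (bodySpec i) le_rfl V _ _ h1 (R + k)
    obtain ⟨b1, b2⟩ := hR R
    rw [← add_assoc]
    exact ⟨a1.trans b1, fun e c => b2 (by omega) (a2 (by omega) c)⟩

theorem amps_run (i k V z : ℕ) (hz : 2 ∣ z) : ∃ X, 2 ∣ X ∧
    4 ^ V * X = 4 ^ (fastF (i + 1))^[k] V * z ∧ ∀ (P : Program) (γ β : Config),
      P.Run (scaled ((fastF (i + 1))^[k] V) z + γ) β →
      (amps i k P).Run (scaled V X + single (7 + 2 * i) (k * (4 ^ V * X)) + γ) β := by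
  induction k generalizing V with
  | zero => exact ⟨z, hz, rfl, fun P γ β h => by simpa [amps] using h⟩
  | succ k ih =>
    obtain ⟨X', hX', e', r'⟩ := ih (fastF (i + 1) V)
    obtain ⟨X, hX, e, r⟩ := amp_run (bodyRun i) (one_dvd 2) V X' hX'
    rw [one_mul] at e
    refine ⟨X, hX, e.trans e', fun P γ β h => ?_⟩
    refine Run.seq (r.of_add (testFree_amp _ _)
      (single (7 + 2 * i) (k * (4 ^ fastF (i + 1) V * X')) + γ) ?_ rfl) ?_
    · rw [← e, Nat.add_mul, one_mul, single_add]; abel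
    · have := r' P γ β h
      rwa [add_assoc] at this

theorem fastF_one_iterate (m n : ℕ) : (fastF 1)^[m] n + 1 = 2 ^ m * (n + 1) := by
  induction m with
  | zero => simp
  | succ m ih =>
    rw [Function.iterate_succ_apply', fastF_one, pow_succ]
    linarith

theorem fastF_two (n : ℕ) : fastF 2 n + 1 = 2 ^ (n + 1) * (n + 1) := fastF_one_iterate (n + 1) n

theorem testFree_amps {i k : ℕ} {P : Program} (h : P.TestFree) : (amps i k P).TestFree := by
  induction k with
  | zero => exact h
  | succ k ih => exact ⟨testFree_amp _ _, ih⟩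

theorem testFree_startBody (a b o : ℕ) : (startBody a b o).TestFree :=
  testFree_incs (testFree_incs trivial)

theorem testFree_start {v a b o : ℕ} {P : Program} (h : P.TestFree) : (start v a b o P).TestFree :=
  testFree_incs ⟨testFree_startBody _ _ _, testFree_startBody _ _ _, h⟩

theorem testFree_mainPart (e n : ℕ) : (mainPart e n).TestFree := by
  cases e with
  | zero => exact testFree_start ⟨testFree_expo _, testFree_settle⟩
  | succ e =>
    exact testFree_start (testFree_amps ⟨testFree_step _ _ _ _ _ _ _ _, testFree_expo _,
      testFree_settle⟩)

theorem counters_startBody (a b o : ℕ) : (startBody a b o).counters ⊆ {0, 1, o} := by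
  rw [startBody, counters_incs, counters_incs, counters]
  split_ifs <;> intro z <;> simp <;> tauto

theorem counters_amps (i k : ℕ) (P : Program) : (amps i (k + 1) P).counters =
    Finset.range (8 + 2 * i) ∪ P.counters := by
  induction k with
  | zero => rw [amps, counters, amps, counters_amp]
  | succ k ih => rw [amps, counters, ih, counters_amp, ← Finset.union_assoc, Finset.union_self]

theorem counters_mainPart (e n : ℕ) : (mainPart e n).counters = Finset.range (8 + 2 * e) := by
  cases e with
  | zero =>
    have h := counters_startBody (2 * fastF 2 n) 0 0
    simp only [mainPart, start, counters_incs, counters, counters_expo, counters_settle]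
    apply Finset.Subset.antisymm
    · intro z hz
      have := @h z
      simp at hz this ⊢
      rcases hz with hz | hz
      · have := this hz; omega
      · omega
    · intro z hz
      simp at hz ⊢
      tauto
  | succ e =>
    have h := counters_startBody (4 ^ n - 1) ((n + 2) * 4 ^ n) (9 + 2 * e)
    simp only [mainPart, start, counters_incs, counters, counters_expo, counters_settle,
      counters_amps, counters_step (show 1 ≤ 1 by norm_num)]
    apply Finset.Subset.antisymm
    · intro z hz
      have := @h z
      simp at hz this ⊢
      split_ifs at hz <;> simp at hz <;> by_cases hs : z ∈ (startBody (4 ^ n - 1)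
        ((n + 2) * 4 ^ n) (9 + 2 * e)).counters <;> simp [hs] at hz this <;> omega
    · intro z hz
      rw [show 8 + 2 * (e + 1) = 10 + 2 * e by ring] at *
      split_ifs <;> simp at hz ⊢ <;> tauto

theorem counters_tests (c : ℕ) (cs : List ℕ) : (tests c cs).counters = (c :: cs).toFinset := by
  induction cs generalizing c with
  | nil => simp [tests, counters]
  | cons c' cs ih => rw [tests, counters, counters, ih]; ext z; simp; tauto

theorem tested_tests (c : ℕ) (cs : List ℕ) : (tests c cs).tested = (c :: cs).toFinset := by
  induction cs generalizing c with
  | nil => simp [tests, tested]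
  | cons c' cs ih => rw [tests, tested, tested, ih]; ext z; simp; tauto

theorem tested_of_testFree {M : Program} (h : M.TestFree) : M.tested = ∅ := by
  induction M with
  | inc c => rfl
  | dec c => rfl
  | test c => exact h.elim
  | loop M ih => exact ih h
  | seq M N ihM ihN => rw [tested, ihM h.1, ihN h.2, Finset.union_empty]
  | or M N ihM ihN => rw [tested, ihM h.1, ihN h.2, Finset.union_empty]

theorem counters_preamp (e n : ℕ) : (preamp e n).counters = Finset.range (8 + 2 * e) := by
  rw [preamp, withTests, counters, counters_mainPart, counters_tests, Finset.union_eq_left]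
  intro z hz
  simp at hz ⊢
  grind

theorem dimension_preamp (e n : ℕ) : (preamp e n).dimension = 2 * (e + 1) + 6 := by
  rw [dimension, counters_preamp, Finset.card_range]; ring

/-- The safe counters are the exponent `4` and the controls from `8` on. Soundness uses the tests of
`0`, `1`, `3`, `7` and the top budget; those of the budgets in between serve this count. -/
theorem safe_preamp (e n : ℕ) : ((preamp e n).safe 2 5 6).card = e + 1 := by
  have : (preamp e n).safe 2 5 6 =
      insert 4 ((Finset.range e).image (fun k => 8 + 2 * k)) := by
    rw [safe, counters_preamp, preamp, withTests, tested,
      tested_of_testFree (testFree_mainPart e n),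
      tested_tests]
    ext z
    simp only [Finset.mem_sdiff, Finset.mem_range, Finset.mem_union, Finset.mem_insert,
      Finset.mem_singleton, List.mem_toFinset, List.mem_cons, List.mem_map, List.mem_range,
      Finset.mem_image, Finset.notMem_empty, false_or]
    constructor
    · rintro ⟨h1, h2⟩
      push Not at h2
      obtain ⟨⟨g1, g2, g3⟩, g4, g5, g6, g7⟩ := h2
      by_cases h4 : z = 4
      · exact .inl h4
      · right
        have : z % 2 = 0 := by
          by_contra hz
          exact g7 ((z - 7) / 2) (by omega) (by omega)
        exact ⟨(z - 8) / 2, by omega, by omega⟩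
    · rintro (rfl | ⟨k, hk, rfl⟩)
      · refine ⟨by omega, ?_⟩
        rintro (h | h | h | h | ⟨k, h⟩) <;> omega
      · refine ⟨by omega, ?_⟩
        rintro (h | h | h | h | ⟨k, h⟩) <;> omega
  rw [this, Finset.card_insert_of_notMem, Finset.card_image_of_injective, Finset.card_range]
  · intro a b h; simpa using h
  · simp; omega

/-! ### Correctness of the preamplifiers -/

theorem sum_two_pow (V z : ℕ) :
    z + (∑ i ∈ Finset.range (2 * V), 2 ^ i) * z = 4 ^ V * z := by
  have h := geom_sum_mul_add (1 : ℕ) (2 * V)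
  rw [mul_one, one_add_one_eq_two, pow_mul] at h
  rw [show (4 : ℕ) = 2 ^ 2 by norm_num, ← h]
  ring

theorem mem_tested_list {e z : ℕ} :
    z ∈ (0 :: 1 :: 3 :: (List.range (e + 1)).map (fun k => 7 + 2 * k)) ↔
      z = 0 ∨ z = 1 ∨ z = 3 ∨ ∃ k ≤ e, z = 7 + 2 * k := by
  simp [eq_comm]

/-- The tests already force `β 5 = 2 ^ V * β 2` and `β 6 = 2 ^ V`, so every run that passes them
gives equality. -/
theorem expo_settle_output {μ V d : ℕ} (hμ : 1 ≤ μ) {α β : Config}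
    (h : (seq (expo μ) settle).Run α β) (a0 : 1 ≤ α 0)
    (a1 : α 1 = (∑ i ∈ Finset.range (2 * V), μ ^ i) * α 0) (a2 : α 2 = 0) (a3 : α 3 = 0)
    (a4 : α 4 = V) (ha : ∀ z, 5 ≤ z → α z = 0)
    (hβ : ∀ z ∈ (0 :: 1 :: 3 :: (List.range (d + 1)).map (fun k => 7 + 2 * k)), β z = 0) :
    β 6 * β 2 ≤ β 5 ∧ (∀ c, c ≠ 2 → c ≠ 5 → c ≠ 6 → β c = 0) ∧
      (β 5 = β 6 * β 2 → β 6 = 2 ^ V) := by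
  simp only [mem_tested_list] at hβ
  have b0 := hβ 0 (.inl rfl)
  have b1 := hβ 1 (.inr (.inl rfl))
  have b3 := hβ 3 (.inr (.inr (.inl rfl)))
  have b7 := hβ 7 (.inr (.inr (.inr ⟨0, by omega, rfl⟩)))
  obtain ⟨b4, b6, b5⟩ := expo_settle_sound hμ h a0 a1 a2 a3 a4 (ha 5 le_rfl) (ha 6 (by omega))
    (ha 7 (by omega)) b0 b1 b3 b7
  refine ⟨by rw [b5, b6], fun c h2 h5 h6 => ?_, fun _ => b6⟩
  by_cases hc : c < 8
  · interval_cases c <;> first | assumption | contradiction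
  · rw [h.frame (by
      rw [counters, counters_expo, counters_settle]; simp; omega)]
    exact ha c (by omega)

theorem preamp_zero_sound {n : ℕ} {β : Config} (h : (preamp 0 n).Run 0 β) :
    β 6 * β 2 ≤ β 5 ∧ (∀ c, c ≠ 2 → c ≠ 5 → c ≠ 6 → β c = 0) ∧
      (β 5 = β 6 * β 2 → β 6 = 2 ^ fastF 2 n) := by
  obtain ⟨h1, h2⟩ := run_withTests.1 h
  obtain ⟨m, hm, h3⟩ := run_start.1 h1
  refine expo_settle_output (V := fastF 2 n) le_rfl h3 ?_ ?_ ?_ ?_ ?_ (fun z hz => ?_) h2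
  · simpa using hm
  · simp [mul_comm]
  · simp
  · simp
  · simp
  · rw [Finsupp.add_apply, Finsupp.add_apply, Finsupp.add_apply, single_eq_of_ne,
      single_eq_of_ne, single_eq_of_ne,
      single_eq_of_ne] <;> omega

/-- This closing pass changes neither `x` nor `y`; its completeness proves that the last amplifier
left its lower budgets empty. -/
theorem return_pays (i V : ℕ) : Pays (balance 1 (pool (i + 1)) (7 + 2 * i)) 1
    (step 1 1 0 1 2 3 (7 + 2 * i) 1) (Clean i V)
    (fun β => Ratio V V β ∧ ∀ k ≤ i, β (5 + 2 * k) = 0 ∧ β (6 + 2 * k) = 0) := by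
  have ho : 7 + 2 * i ∉ pool (i + 1) := by
    rw [show 7 + 2 * i = 5 + 2 * (i + 1) by ring]; exact budget_notMem_pool _
  refine step_pays le_rfl le_rfl (by decide) (le_three_mem_pool (by norm_num))
    (le_three_mem_pool (by norm_num)) (le_three_mem_pool (by norm_num))
    (le_three_mem_pool (by norm_num)) (le_three_mem_pool (by norm_num)) ho
    (by omega) (by omega) (by omega) ?_
  intro α β hf hα h0 h
  obtain ⟨hα, hv⟩ := hα fun k hk => h0 _ (budget_mem_pool (by omega)) (by omega) (by omega)
    (by omega) (by omega)
  obtain ⟨j, a0, b0, b1, hz⟩ := h hα.two hα.three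
  have hp := hα.pos
  have hs := hα.sum
  have e0 : β 0 = α 0 := by omega
  have e1 : β 1 = α 1 := by simpa using b1
  refine ⟨⟨by omega, by rw [e0, e1, hs],
    hz 2 (le_three_mem_pool (by norm_num)) (by omega) (by omega),
    hz 3 (le_three_mem_pool (by norm_num)) (by omega) (by omega), ?_⟩, fun k hk => ⟨?_, ?_⟩⟩
  · rw [hf 4 (by simp; omega), hα.four]
  · exact hz _ (budget_mem_pool (by omega)) (by omega) (by omega)
  · rw [hf _ (by simp; omega), hv k hk]

theorem preamp_succ_sound {e n : ℕ} {β : Config} (h : (preamp (e + 1) n).Run 0 β) :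
    β 6 * β 2 ≤ β 5 ∧ (∀ c, c ≠ 2 → c ≠ 5 → c ≠ 6 → β c = 0) ∧
      (β 5 = β 6 * β 2 → β 6 = 2 ^ fastF (e + 3) n) := by
  obtain ⟨h1, h2⟩ := run_withTests.1 h
  obtain ⟨m, hm, h3⟩ := run_start.1 h1
  obtain ⟨k, hk⟩ := exists_pow_eq_succ (b := 4) (by norm_num) n
  generalize hα : single 4 n + single 1 (m * (4 ^ n - 1)) +
    single (9 + 2 * e) (m * ((n + 2) * 4 ^ n)) + single 0 m = α at h3
  have a0 : α 0 = m := by subst hα; simp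
  have a1 : α 1 = k * m := by
    subst hα
    rw [Finsupp.add_apply, Finsupp.add_apply, Finsupp.add_apply, single_eq_of_ne,
      single_eq_same, single_eq_of_ne,
      single_eq_of_ne, hk] <;> first | omega | simp [mul_comm]
  have a4 : α 4 = n := by
    subst hα
    rw [Finsupp.add_apply, Finsupp.add_apply, Finsupp.add_apply, single_eq_same,
      single_eq_of_ne, single_eq_of_ne,
      single_eq_of_ne] <;> omega
  have ao : α (9 + 2 * e) = m * ((n + 2) * 4 ^ n) := by
    subst hα
    rw [Finsupp.add_apply, Finsupp.add_apply, Finsupp.add_apply, single_eq_of_ne,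
      single_eq_of_ne, single_eq_same,
      single_eq_of_ne] <;> omega
  have az : ∀ z, z ≠ 0 → z ≠ 1 → z ≠ 4 → z ≠ 9 + 2 * e → α z = 0 := by
    subst hα
    intro z _ _ _ _
    rw [Finsupp.add_apply, Finsupp.add_apply, Finsupp.add_apply, single_eq_of_ne,
      single_eq_of_ne, single_eq_of_ne,
      single_eq_of_ne] <;> omega
  -- The content is `4^n m` and stays constant as `μ = 1`; the `n + 2` passes are `n + 1` amplifiers
  -- and the closing pass.
  have hbal : balance 1 (pool (e + 1 + 1)) (7 + 2 * (e + 1)) (1 + (n + 1)) α = 0 := by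
    have ht : total (pool (e + 2)) α = 4 ^ n * m := by
      have : ∀ i ≤ e + 2, total (pool i) α = 4 ^ n * m := by
        intro i
        induction i with
        | zero => intro _; rw [total_pool_zero, a0, a1, az 2, az 3, hk] <;> first | omega | ring
        | succ i ih =>
          intro hi
          rw [total_pool_succ, ih (by omega), az] <;> omega
      exact this _ le_rfl
    rw [balance, ht, show 7 + 2 * (e + 1) = 9 + 2 * e by ring, ao]
    simp
    ring
  have hclean : Clean (e + 1) n α := fun _ =>
    ⟨⟨by omega, by rw [a0, a1, hk]; ring, az 2 (by omega) (by omega) (by omega) (by omega),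
      az 3 (by omega) (by omega) (by omega) (by omega), a4⟩,
      fun k _ => az _ (by omega) (by omega) (by omega) (by omega)⟩
  obtain ⟨ρ, ⟨τ, h5, h6⟩, h4⟩ := run_amps (V := n) h3
  obtain ⟨c1, c2⟩ := h4 1
  rw [show 9 + 2 * e = 7 + 2 * (e + 1) by ring] at h5
  obtain ⟨d1, d2⟩ := return_pays (e + 1) ((fastF (e + 1 + 1))^[n + 1] n) _ _ h5 0
  -- The final part does not touch the top budget, so its test at the end applies to `τ`.
  have hτ : balance 1 (pool (e + 1 + 1)) (7 + 2 * (e + 1)) 0 τ = 0 := by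
    have : β (7 + 2 * (e + 1)) = τ (7 + 2 * (e + 1)) := h6.frame (by
      rw [counters, counters_expo, counters_settle]; simp; omega)
    rw [balance, ← this, h2 _ (mem_tested_list.2 (.inr (.inr (.inr ⟨e + 1, by omega, rfl⟩))))]
    simp
  rw [zero_add] at d1 d2
  obtain ⟨hr, hz⟩ := d2 (by omega) (c2 (by omega) hclean)
  refine expo_settle_output (V := fastF (e + 3) n) (by norm_num) h6 hr.pos ?_ hr.two hr.three
    hr.four (fun z hz5 => ?_) h2
  · have h7 := hr.sum
    have h8 := sum_two_pow (fastF (e + 3) n) (τ 0)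
    have h9 : (fastF (e + 1 + 1))^[n + 1] n = fastF (e + 3) n := rfl
    rw [h9] at h7
    omega
  · rcases lt_trichotomy z (9 + 2 * e) with hlt | heq | hgt
    · rcases Nat.even_or_odd' z with ⟨k, rfl | rfl⟩
      · have := (hz (k - 3) (by omega)).2
        rwa [show 6 + 2 * (k - 3) = 2 * k by omega] at this
      · have := (hz (k - 2) (by omega)).1
        rwa [show 5 + 2 * (k - 2) = 2 * k + 1 by omega] at this
    · rw [balance] at hτ
      rw [heq, show 9 + 2 * e = 7 + 2 * (e + 1) by ring]
      simpa using hτ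
    · have f1 := h.frame (z := z) (by rw [counters_preamp]; simp; omega)
      have f2 : β z = τ z := h6.frame (by
        rw [counters, counters_expo, counters_settle]; simp; omega)
      rw [← f2, f1]; rfl

theorem output_eq_zero {l V e : ℕ} : ∀ z ∈ (0 :: 1 :: 3 :: (List.range (e + 1)).map
    (fun k => 7 + 2 * k)),
    (single 2 l + single 5 (2 ^ V * l) + single 6 (2 ^ V) : Config) z = 0 := by
  intro z hz
  rw [mem_tested_list] at hz
  rw [Finsupp.add_apply, Finsupp.add_apply, single_eq_of_ne, single_eq_of_ne,
    single_eq_of_ne] <;> grind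

theorem preamp_run (e n l : ℕ) (hl : 1 ≤ l) :
    (preamp e n).Run 0 (single 2 l + single 5 (2 ^ fastF (e + 2) n * l) +
      single 6 (2 ^ fastF (e + 2) n)) := by
  refine run_withTests.2 ⟨?_, output_eq_zero⟩
  cases e with
  | zero =>
    -- With `μ = 1` the passes only halve `x`, so this ends at exactly `l` and nothing is discarded.
    refine run_start.2 ⟨2 ^ fastF 2 n * l, Nat.mul_pos (by positivity) hl, ?_⟩
    convert expo_settle_run le_rfl (fastF 2 n) le_rfl using 1
    simp [mul_comm]
    abel
  | succ e =>
    -- The power of two serves the halvings in `expo`; the factor `2` secures evenness, and `settle`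
    -- discards the surplus.
    obtain ⟨X, hX, hXV, hrun⟩ := amps_run (e + 1) (n + 1) n (2 ^ fastF (e + 3) n * (2 * l))
      ⟨2 ^ fastF (e + 3) n * l, by ring⟩
    have hV : (fastF (e + 1 + 1))^[n + 1] n = fastF (e + 3) n := rfl
    rw [hV] at hXV hrun
    generalize fastF (e + 3) n = V at *
    have hX1 : 1 ≤ X := by
      rcases Nat.eq_zero_or_pos X with rfl | h
      · have : 0 < 4 ^ V * (2 ^ V * (2 * l)) := by positivity
        omega
      · exact h
    refine run_start.2 ⟨X, hX1, ?_⟩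
    have h1 := step_run (a := 1) (μ := 1) le_rfl le_rfl 0 1 2 3 (9 + 2 * e) 1 (2 ^ V * (2 * l))
      ((4 ^ V - 1) * (2 ^ V * (2 * l)))
    have h2 := expo_settle_run (μ := 2) (by norm_num) V (l := l) (l' := 2 * l) (by omega)
    obtain ⟨k, hk⟩ := exists_pow_eq_succ (b := 4) (by norm_num) V
    have hs := sum_two_pow V (2 ^ V * (2 * l))
    have h3 := hrun (seq (step 1 1 0 1 2 3 (9 + 2 * e) 1) (seq (expo 2) settle))
      (single (9 + 2 * e) (4 ^ n * X)) _ (Run.seq (h1.of_add (testFree_step _ _ _ _ _ _ _ _)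
        (single 4 V) ?_ ?_) h2)
    · convert h3 using 1
      rw [scaled, show X * ((n + 2) * 4 ^ n) = (n + 1) * (4 ^ n * X) + 4 ^ n * X by ring,
        single_add, mul_comm X, show 7 + 2 * (e + 1) = 9 + 2 * e by ring]
      abel
    · rw [scaled, hXV, one_mul, show 2 ^ V * (2 * l) + (4 ^ V - 1) * (2 ^ V * (2 * l)) =
        4 ^ V * (2 ^ V * (2 * l)) by rw [hk, Nat.add_sub_cancel]; ring]
      abel
    · rw [one_mul, one_mul, Nat.sub_self, zero_mul, add_zero]
      congr 3
      rw [hk, Nat.add_sub_cancel]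
      rw [hk, Nat.add_mul, one_mul] at hs
      omega

theorem preamp_isPreamplifier (e n : ℕ) :
    (preamp e n).IsPreamplifier (2 ^ fastF (e + 2) n) 2 5 6 where
  x_ne_y := by norm_num
  x_ne_b := by norm_num
  y_ne_b := by norm_num
  checking := ⟨_, _, testFree_mainPart e n, rfl⟩
  sound β h := by
    cases e with
    | zero => exact preamp_zero_sound h
    | succ e => exact preamp_succ_sound h
  complete l hl := by
    refine ⟨_, preamp_run e n l hl, ?_, ?_⟩ <;> simp

/-! ### Renaming counters -/

/-- Rename the counters of a program. -/
def rename (f : ℕ → ℕ) : Program → Program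
  | inc c => inc (f c)
  | dec c => dec (f c)
  | test c => test (f c)
  | loop M => loop (M.rename f)
  | seq M N => seq (M.rename f) (N.rename f)
  | or M N => or (M.rename f) (N.rename f)

theorem rename_incs (f : ℕ → ℕ) (c m : ℕ) (P : Program) :
    (incs c m P).rename f = incs (f c) m (P.rename f) := by
  induction m with
  | zero => rfl
  | succ m ih => rw [incs, rename, ih]; rfl

theorem rename_decs (f : ℕ → ℕ) (c m : ℕ) (P : Program) :
    (decs c m P).rename f = decs (f c) m (P.rename f) := by
  induction m with
  | zero => rfl
  | succ m ih => rw [decs, rename, ih]; rfl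

theorem rename_step (f : ℕ → ℕ) (a μ x y x' y' o t : ℕ) : (step a μ x y x' y' o t).rename f =
    step a μ (f x) (f y) (f x') (f y') (f o) (f t) := by
  simp [step, move, paidMove, rename, rename_incs, rename_decs]

theorem rename_eq_self {f : ℕ → ℕ} {M : Program} (h : ∀ c ∈ M.counters, f c = c) :
    M.rename f = M := by
  induction M with
  | inc c => rw [rename, h c (by simp [counters])]
  | dec c => rw [rename, h c (by simp [counters])]
  | test c => rw [rename, h c (by simp [counters])]
  | loop M ih => rw [rename, ih h]
  | seq M N ihM ihN =>
    rw [rename, ihM fun c hc => h c (by simp [counters, hc]),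
      ihN fun c hc => h c (by simp [counters, hc])]
  | or M N ihM ihN =>
    rw [rename, ihM fun c hc => h c (by simp [counters, hc]),
      ihN fun c hc => h c (by simp [counters, hc])]

theorem size_le_length_encode (M : Program) : M.size ≤ M.encode.length := by
  induction M with
  | loop M ih => simp only [size, encode, List.length_cons]; omega
  | seq M N ihM ihN => simp only [size, encode, List.length_cons, List.length_append]; omega
  | or M N ihM ihN => simp only [size, encode, List.length_cons, List.length_append]; omega
  | _ => simp [size, encode]

end Program

namespace Ram

open Function Program

/-! ### Reasoning about machines -/

theorem Exec.length_out_le {P : Ram} {σ τ : State} {t : ℕ} (h : Exec P σ t τ) :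
    τ.out.length ≤ σ.out.length + t := by
  induction h with
  | write i σ => simp
  | const | add | sub | load | store => simp [State.set]
  | _ => omega

/-- Within `T` steps, `P` changes the memory from `m` to `m'` and writes `w`. The contents of the
scratch register `2` are disregarded. -/
def Does (P : Ram) (T : ℕ) (m m' : ℕ → ℕ) (w : List ℕ) : Prop :=
  ∀ σ : State, (∀ r, r ≠ 2 → σ.mem r = m r) →
    ∃ t τ, t ≤ T ∧ Exec P σ t τ ∧ (∀ r, r ≠ 2 → τ.mem r = m' r) ∧ τ.out = σ.out ++ w

theorem Does.mono {P : Ram} {T T' : ℕ} {m m' : ℕ → ℕ} {w : List ℕ} (h : P.Does T m m' w)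
    (hT : T ≤ T') : P.Does T' m m' w := fun σ hσ =>
  let ⟨t, τ, ht, h'⟩ := h σ hσ
  ⟨t, τ, ht.trans hT, h'⟩

theorem Does.of {P : Ram} {T T' : ℕ} {m m' m'' : ℕ → ℕ} {w w' : List ℕ} (h : P.Does T m m' w)
    (hT : T ≤ T') (hm : ∀ r, r ≠ 2 → m' r = m'' r) (hw : w = w') : P.Does T' m m'' w' :=
  fun σ hσ =>
    let ⟨t, τ, ht, h1, h2, h3⟩ := h σ hσ
    ⟨t, τ, ht.trans hT, h1, fun r hr => (h2 r hr).trans (hm r hr), hw ▸ h3⟩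

theorem Does.seq {P Q : Ram} {T U : ℕ} {m m' m'' : ℕ → ℕ} {w w' : List ℕ} (h : P.Does T m m' w)
    (h' : Q.Does U m' m'' w') : (P.seq Q).Does (T + U) m m'' (w ++ w') := by
  intro σ hσ
  obtain ⟨t, ρ, ht, h1, h2, h3⟩ := h σ hσ
  obtain ⟨u, τ, hu, h4, h5, h6⟩ := h' ρ h2
  exact ⟨t + u, τ, add_le_add ht hu, .seq h1 h4, h5, by rw [h6, h3, List.append_assoc]⟩

theorem does_const (m : ℕ → ℕ) (i k : ℕ) : (const i k).Does 1 m (update m i k) [] := by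
  intro σ hσ
  refine ⟨1, _, le_rfl, .const i k σ, fun r hr => ?_, by simp [State.set]⟩
  simp only [State.set, update_apply, hσ r hr]

theorem does_add (m : ℕ → ℕ) (i : ℕ) {j k : ℕ} (hj : j ≠ 2) (hk : k ≠ 2) :
    (add i j k).Does 1 m (update m i (m j + m k)) [] := by
  intro σ hσ
  refine ⟨1, _, le_rfl, .add i j k σ, fun r hr => ?_, by simp [State.set]⟩
  simp only [State.set, update_apply, hσ r hr, hσ j hj, hσ k hk]

theorem does_sub (m : ℕ → ℕ) (i : ℕ) {j k : ℕ} (hj : j ≠ 2) (hk : k ≠ 2) :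
    (sub i j k).Does 1 m (update m i (m j - m k)) [] := by
  intro σ hσ
  refine ⟨1, _, le_rfl, .sub i j k σ, fun r hr => ?_, by simp [State.set]⟩
  simp only [State.set, update_apply, hσ r hr, hσ j hj, hσ k hk]

theorem Does.ite_true {P Q : Ram} {i T : ℕ} {m m' : ℕ → ℕ} {w : List ℕ} (h : P.Does T m m' w)
    (hi : i ≠ 2) (h0 : m i ≠ 0) : (ite i P Q).Does (T + 1) m m' w := by
  intro σ hσ
  obtain ⟨t, τ, ht, h1, h2⟩ := h σ hσ
  exact ⟨t + 1, τ, by omega, .ite_true (by rwa [hσ i hi]) h1, h2⟩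

theorem Does.ite_false {P Q : Ram} {i T : ℕ} {m m' : ℕ → ℕ} {w : List ℕ} (h : Q.Does T m m' w)
    (hi : i ≠ 2) (h0 : m i = 0) : (ite i P Q).Does (T + 1) m m' w := by
  intro σ hσ
  obtain ⟨t, τ, ht, h1, h2⟩ := h σ hσ
  exact ⟨t + 1, τ, by omega, .ite_false (by rwa [hσ i hi]) h1, h2⟩

theorem does_while_false {P : Ram} {i : ℕ} {m : ℕ → ℕ} (hi : i ≠ 2) (h0 : m i = 0) :
    (Ram.while i P).Does 1 m m [] := fun σ hσ =>
  ⟨1, σ, le_rfl, .while_false (by rwa [hσ i hi]), hσ, by simp⟩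

theorem Does.while_true {P : Ram} {i T U : ℕ} {m m' m'' : ℕ → ℕ} {w w' : List ℕ}
    (h : P.Does T m m' w) (h' : (Ram.while i P).Does U m' m'' w') (hi : i ≠ 2) (h0 : m i ≠ 0) :
    (Ram.while i P).Does (T + U + 1) m m'' (w ++ w') := by
  intro σ hσ
  obtain ⟨t, ρ, ht, h1, h2, h3⟩ := h σ hσ
  obtain ⟨u, τ, hu, h4, h5, h6⟩ := h' ρ h2
  exact ⟨t + u + 1, τ, by omega, .while_true (by rwa [hσ i hi]) h1 h4, h5,
    by rw [h6, h3, List.append_assoc]⟩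

/-- A loop with the loop counter in register `i`, where `S k` is the memory and `W k` remains to
be written before the last `k` rounds. -/
theorem does_while {P : Ram} {i T : ℕ} {S : ℕ → ℕ → ℕ} {W : ℕ → List ℕ} (hi : i ≠ 2)
    (hS : ∀ k, S k i = k) (h0 : W 0 = [])
    (h : ∀ k, ∃ w, W (k + 1) = w ++ W k ∧ P.Does T (S (k + 1)) (S k) w) (k : ℕ) :
    (Ram.while i P).Does (k * (T + 1) + 1) (S k) (S 0) (W k) := by
  induction k with
  | zero => rw [h0, zero_mul]; exact does_while_false hi (hS 0)
  | succ k ih =>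
    obtain ⟨w, hw, h1⟩ := h k
    rw [hw]
    exact (h1.while_true ih hi (by rw [hS]; omega)).mono (by rw [Nat.add_mul]; omega)

/-! ### Printing programs -/

/-- Print a constant. -/
def literal (k : ℕ) : Ram := seq (const 2 k) (write 2)

/-- Print a program in prefix notation. Counters from `8` on are replaced by the contents of the
registers of the same number. -/
def print : Program → Ram
  | .inc c => seq (literal 0) (if c < 8 then literal c else write c)
  | .dec c => seq (literal 1) (if c < 8 then literal c else write c)
  | .test c => seq (literal 2) (if c < 8 then literal c else write c)
  | .loop M => seq (literal 3) (print M)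
  | .seq M N => seq (literal 4) (seq (print M) (print N))
  | .or M N => seq (literal 5) (seq (print M) (print N))

/-- The counter denoted by `c` in a printing instruction. -/
def value (m : ℕ → ℕ) (c : ℕ) : ℕ := if c < 8 then c else m c

theorem does_literal (m : ℕ → ℕ) (k : ℕ) : (literal k).Does 2 m m [k] := by
  intro σ hσ
  refine ⟨2, _, le_rfl, .seq (.const 2 k σ) (.write 2 _), fun r hr => ?_, by simp [State.set]⟩
  simp [State.set, hr, hσ r hr]

theorem does_counter (m : ℕ → ℕ) (c : ℕ) :
    (if c < 8 then literal c else write c).Does 2 m m [value m c] := by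
  rw [value]
  split_ifs with h
  · exact does_literal m c
  · exact fun σ hσ => ⟨1, _, by omega, .write c σ, hσ, by simp [hσ c (by omega)]⟩

theorem does_print (m : ℕ → ℕ) (M : Program) :
    (print M).Does (4 * M.size) m m (M.rename (value m)).encode := by
  induction M with
  | inc c => exact (does_literal m 0).seq (does_counter m c)
  | dec c => exact (does_literal m 1).seq (does_counter m c)
  | test c => exact (does_literal m 2).seq (does_counter m c)
  | loop M ih => exact ((does_literal m 3).seq ih).mono (by rw [Program.size]; omega)
  | seq M N ihM ihN =>
    exact ((does_literal m 4).seq (ihM.seq ihN)).mono (by rw [Program.size]; omega)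
  | or M N ihM ihN =>
    exact ((does_literal m 5).seq (ihM.seq ihN)).mono (by rw [Program.size]; omega)

theorem does_print_closed (m : ℕ → ℕ) {M : Program} (h : M.counters ⊆ Finset.range 8) :
    (print M).Does (4 * M.size) m m M.encode := by
  have := does_print m M
  rwa [rename_eq_self (f := value m) fun c hc => if_pos (Finset.mem_range.1 (h hc))] at this

/-- `k` copies of a word. -/
def copies (k : ℕ) (w : List ℕ) : List ℕ := (List.replicate k w).flatten

theorem copies_succ (k : ℕ) (w : List ℕ) : copies (k + 1) w = w ++ copies k w := by
  simp [copies, List.replicate_succ]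

/-- Print the beginning of `R[i]` increments of the counter `c`. -/
def printIncs (i c : ℕ) : Ram :=
  .while i (seq (literal 4) (seq (print (.inc c)) (sub i i 3)))

theorem does_printIncs {m : ℕ → ℕ} {i c : ℕ} (hi : i ≠ 2) (hi3 : i ≠ 3) (hc : c ≠ i)
    (h3 : m 3 = 1) :
    (printIncs i c).Does (m i * 8 + 1) m (update m i 0) (copies (m i) [4, 0, value m c]) := by
  have := does_while (i := i) (P := seq (literal 4) (seq (print (.inc c)) (sub i i 3))) (T := 7)
    (S := fun k => update m i k) (W := fun k => copies k [4, 0, value m c]) hi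
    (by simp) rfl (fun k => ⟨_, copies_succ _ _, ?_⟩) (m i)
  · rw [update_eq_self] at this
    exact this
  · refine ((does_literal _ 4).seq ((does_print _ (.inc c)).seq
      (does_sub _ i hi (by norm_num)))).of le_rfl ?_ ?_
    · simp [update_of_ne hi3.symm, h3]
    · simp [rename, encode, value, hc]

/-! ### Printing the amplifiers -/

/-- The beginning of an amplifier, up to the amplifier of the next lower level. -/
def levelWord (μ o c t : ℕ) : List ℕ :=
  4 :: (step 2 μ 0 1 2 3 o t).encode ++
    4 :: (Program.loop (.seq (.dec 4) (.seq (.inc c) (.inc 6)))).encode ++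
    4 :: (Program.inc c).encode ++ 4 :: (Program.loop (.seq (.dec 6) (incr t))).encode ++
    3 :: 4 :: (Program.dec c).encode

/-- The lower amplifier is the last subterm, so its word is a suffix and a loop can print the levels
without a stack. -/
theorem encode_amp_succ (i μ : ℕ) : (amp (i + 1) μ).encode =
    levelWord μ (9 + 2 * i) (8 + 2 * i) (7 + 2 * i) ++ (amp i 2).encode := by
  rw [amp, ampBody_succ, show 7 + 2 * (i + 1) = 9 + 2 * i by ring,
    show 5 + 2 * (i + 1) = 7 + 2 * i by ring]
  simp [levelWord, encode]

/-- The beginning of `amp k 2`, up to `amp 0 2`. -/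
def levels : ℕ → List ℕ
  | 0 => []
  | k + 1 => levelWord 2 (9 + 2 * k) (8 + 2 * k) (7 + 2 * k) ++ levels k

theorem encode_amp_two (k : ℕ) : (amp k 2).encode = levels k ++ (amp 0 2).encode := by
  induction k with
  | zero => rfl
  | succ k ih => rw [encode_amp_succ, ih, levels, List.append_assoc]

/-- The counters `8`, `9`, `10` are placeholders for the paying budget, the control and the budget
being filled. -/
def printLevel (μ : ℕ) : Ram :=
  seq (literal 4) (seq (print (step 2 μ 0 1 2 3 8 10)) (seq (literal 4)
    (seq (print (.loop (.seq (.dec 4) (.seq (.inc 9) (.inc 6))))) (seq (literal 4)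
      (seq (print (.inc 9)) (seq (literal 4) (seq (print (.loop (.seq (.dec 6) (incr 10))))
        (seq (literal 3) (seq (literal 4) (print (.dec 9)))))))))))

theorem does_printLevel (m : ℕ → ℕ) {μ : ℕ} (hμ : μ ≤ 2) :
    (printLevel μ).Does 500 m m (levelWord μ (m 8) (m 9) (m 10)) := by
  refine ((does_literal m 4).seq ((does_print m _).seq ((does_literal m 4).seq
    ((does_print m _).seq ((does_literal m 4).seq ((does_print m _).seq ((does_literal m 4).seq
      ((does_print m _).seq ((does_literal m 3).seq ((does_literal m 4).seq
        (does_print m _))))))))))).of ?_ (fun _ _ => rfl) ?_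
  -- The bound `500` is checked by evaluating the program sizes for each `μ`.
  · interval_cases μ <;> decide
  · simp [rename_step, incr, rename, levelWord, encode, value]

/-- The memory that is needed to print an amplifier of level `k`. -/
def levelMem (m : ℕ → ℕ) (k : ℕ) : ℕ → ℕ :=
  update (update (update (update m 8 (7 + 2 * k)) 9 (6 + 2 * k)) 10 (5 + 2 * k)) 11 k

theorem levelMem_apply (m : ℕ → ℕ) (k : ℕ) {r : ℕ} (hr : r < 8 ∨ 11 < r) :
    levelMem m k r = m r := by
  simp only [levelMem]
  rw [update_of_ne (by omega), update_of_ne (by omega), update_of_ne (by omega),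
    update_of_ne (by omega)]

def lowerLevel : Ram := seq (sub 8 8 4) (seq (sub 9 9 4) (seq (sub 10 10 4) (sub 11 11 3)))

theorem does_lowerLevel {m : ℕ → ℕ} (h3 : m 3 = 1) (h4 : m 4 = 2) (k : ℕ) :
    lowerLevel.Does 4 (levelMem m (k + 1)) (levelMem m k) [] := by
  refine ((does_sub _ _ (by norm_num) (by norm_num)).seq ((does_sub _ _ (by norm_num)
    (by norm_num)).seq ((does_sub _ _ (by norm_num) (by norm_num)).seq
      (does_sub _ _ (by norm_num) (by norm_num))))).of le_rfl (fun r _ => ?_) rfl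
  simp [levelMem, update_apply, h3, h4]
  grind

/-- Register `18` is never written and stays zero, so adding it copies a register. -/
def resetLevel : Ram := seq (add 8 6 18) (seq (sub 9 8 3) (seq (sub 10 9 3) (add 11 5 18)))

theorem does_resetLevel {m : ℕ → ℕ} {e : ℕ} (h3 : m 3 = 1) (h5 : m 5 = e) (h6 : m 6 = 7 + 2 * e)
    (h18 : m 18 = 0) : resetLevel.Does 4 m (levelMem m e) [] := by
  refine ((does_add _ _ (by norm_num) (by norm_num)).seq ((does_sub _ _ (by norm_num)
    (by norm_num)).seq ((does_sub _ _ (by norm_num) (by norm_num)).seq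
      (does_add _ _ (by norm_num) (by norm_num))))).of le_rfl (fun r _ => ?_) rfl
  simp [levelMem, update_apply, h3, h5, h6, h18]

def printAmp : Ram :=
  seq (literal 4) (seq (printLevel 1) (seq lowerLevel (seq
    (.while 11 (seq (printLevel 2) lowerLevel)) (seq (print (amp 0 2)) (seq resetLevel
      (sub 12 12 3))))))

theorem does_printLevels {m : ℕ → ℕ} (h3 : m 3 = 1) (h4 : m 4 = 2) (k : ℕ) :
    (Ram.while 11 (seq (printLevel 2) lowerLevel)).Does (k * 505 + 1) (levelMem m k)
      (levelMem m 0) (levels k) := by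
  refine does_while (S := levelMem m) (by norm_num) (fun k => by simp [levelMem]) rfl
    (fun k => ⟨_, rfl, ?_⟩) k
  refine ((does_printLevel _ le_rfl).seq (does_lowerLevel h3 h4 k)).of le_rfl (fun _ _ => rfl) ?_
  rw [List.append_nil]
  simp only [levelMem]
  congr 1 <;> simp <;> ring

theorem does_printAmp {m : ℕ → ℕ} {e k : ℕ} (h3 : m 3 = 1) (h4 : m 4 = 2) (h5 : m 5 = e + 1)
    (h6 : m 6 = 9 + 2 * e) (h18 : m 18 = 0) (h12 : m 12 = k + 1) :
    printAmp.Does (e * 505 + 1400) (levelMem m (e + 1)) (levelMem (update m 12 k) (e + 1))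
      (4 :: (amp (e + 1) 1).encode) := by
  refine ((does_literal _ 4).seq ((does_printLevel _ (by norm_num)).seq
    ((does_lowerLevel h3 h4 e).seq ((does_printLevels h3 h4 e).seq
      ((does_print_closed (M := amp 0 2) _ (by rw [counters_amp])).seq
        ((does_resetLevel (e := e + 1) ?_ ?_ ?_ ?_).seq
          (does_sub _ _ (by norm_num) (by norm_num)))))))).of ?_ (fun r _ => ?_) ?_
  · rw [levelMem_apply _ _ (by omega), h3]
  · rw [levelMem_apply _ _ (by omega), h5]
  · rw [levelMem_apply _ _ (by omega), h6]; ring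
  · rw [levelMem_apply _ _ (by omega), h18]
  · have : (amp 0 2).size ≤ 200 := by decide
    omega
  · simp [levelMem, update_apply, h3, h12]
    grind
  · rw [encode_amp_succ, encode_amp_two e]
    simp [levelMem]
    grind

theorem encode_amps (i k : ℕ) (P : Program) :
    (amps i k P).encode = copies k (4 :: (amp i 1).encode) ++ P.encode := by
  induction k with
  | zero => rfl
  | succ k ih => rw [amps, encode, ih, copies_succ]; simp

theorem does_printAmps {m : ℕ → ℕ} {e : ℕ} (h3 : m 3 = 1) (h4 : m 4 = 2) (h5 : m 5 = e + 1)
    (h6 : m 6 = 9 + 2 * e) (h18 : m 18 = 0) :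
    (Ram.while 12 printAmp).Does (m 12 * (e * 505 + 1401) + 1) (levelMem m (e + 1))
      (levelMem (update m 12 0) (e + 1)) (copies (m 12) (4 :: (amp (e + 1) 1).encode)) := by
  have := does_while (i := 12) (P := printAmp) (T := e * 505 + 1400)
    (S := fun k => levelMem (update m 12 k) (e + 1))
    (W := fun k => copies k (4 :: (amp (e + 1) 1).encode)) (by norm_num)
    (fun k => by rw [levelMem_apply _ _ (by omega), update_self]) rfl
    (fun k => ⟨_, copies_succ _ _, ?_⟩) (m 12)
  · rw [update_eq_self] at this
    exact this
  · have := does_printAmp (m := update m 12 (k + 1)) (e := e) (k := k) (by simpa) (by simpa)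
      (by simpa) (by simpa) (by simpa) (by simp)
    rwa [update_idem] at this

/-! ### Printing the initial part -/

theorem encode_incs (c k : ℕ) (P : Program) :
    (incs c k P).encode = copies k [4, 0, c] ++ P.encode := by
  induction k with
  | zero => rfl
  | succ k ih => rw [incs, encode, ih, copies_succ]; simp [encode]

def printBody : Ram :=
  seq (add 16 14 18) (seq (printIncs 16 1) (seq (add 16 15 18) (seq (printIncs 16 8)
    (print (.inc 0)))))

theorem does_printBody {m : ℕ → ℕ} (h3 : m 3 = 1) (h18 : m 18 = 0) :
    printBody.Does (8 * (m 14 + m 15) + 8) m (update m 16 0)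
      (startBody (m 14) (m 15) (m 8)).encode := by
  refine ((does_add _ _ (by norm_num) (by norm_num)).seq ((does_printIncs (by norm_num)
    (by norm_num) (by norm_num) (by simpa)).seq ((does_add _ _ (by norm_num) (by norm_num)).seq
      ((does_printIncs (by norm_num) (by norm_num) (by norm_num) (by simpa)).seq
        (does_print_closed _ (by decide)))))).of ?_ (fun r _ => ?_) ?_
  · simp [h18, Program.size]; omega
  · simp
  · simp [h18, startBody, encode_incs, value]

def printStart : Ram :=
  seq (printIncs 13 4) (seq (literal 4) (seq printBody (seq (literal 4) (seq (literal 3)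
    printBody))))

theorem does_printStart {m : ℕ → ℕ} (h3 : m 3 = 1) (h18 : m 18 = 0) : ∃ w,
    printStart.Does (8 * m 13 + 16 * (m 14 + m 15) + 30) m (update (update m 13 0) 16 0) w ∧
      ∀ P, (start (m 13) (m 14) (m 15) (m 8) P).encode = w ++ P.encode := by
  refine ⟨_, ((does_printIncs (by norm_num) (by norm_num) (by norm_num) (by simpa)).seq
    ((does_literal _ 4).seq ((does_printBody (by simpa) (by simpa)).seq ((does_literal _ 4).seq
      ((does_literal _ 3).seq (does_printBody (by simpa) (by simpa))))))).of ?_ (fun r _ => ?_) rfl,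
    fun P => ?_⟩
  · simp; omega
  · simp
  · simp [start, encode_incs, encode, value]

/-! ### Printing the tests -/

/-- The beginning of `k + 1` tests of `c`, `c + 2` and so on, without the last test. -/
def testWords : ℕ → ℕ → List ℕ
  | 0, _ => []
  | k + 1, c => 4 :: 2 :: c :: testWords k (c + 2)

theorem encode_tests (c k : ℕ) : (tests c ((List.range k).map (fun j => c + 2 + 2 * j))).encode =
    testWords k c ++ [2, c + 2 * k] := by
  induction k generalizing c with
  | zero => rfl
  | succ k ih =>
    have h := ih (c + 2)
    rw [List.range_succ_eq_map, List.map_cons, List.map_map, tests, encode, testWords]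
    simp only [comp_def, mul_zero, add_zero]
    rw [show (fun j => c + 2 + 2 * (j + 1)) = fun j => c + 2 + 2 + 2 * j by funext j; ring, h]
    simp [encode]
    ring

def testLoop : Ram :=
  .while 5 (seq (literal 4) (seq (print (.test 17)) (seq (add 17 17 4) (sub 5 5 3))))

theorem does_testLoop {m : ℕ → ℕ} (k : ℕ) (h3 : m 3 = 1) (h4 : m 4 = 2) (h5 : m 5 = k) :
    testLoop.Does (k * 9 + 1) m (update (update m 5 0) 17 (m 17 + 2 * k)) (testWords k (m 17)) := by
  induction k generalizing m with
  | zero =>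
    refine (does_while_false (by norm_num) h5).of (by omega) (fun r _ => ?_) rfl
    simp only [update_apply]
    split_ifs <;> simp_all
  | succ k ih =>
    have h := ((does_literal m 4).seq ((does_print m (.test 17)).seq ((does_add m 17
      (show 17 ≠ 2 by norm_num) (show 4 ≠ 2 by norm_num)).seq
        (does_sub _ 5 (show 5 ≠ 2 by norm_num) (show 3 ≠ 2 by norm_num)))))
    refine (h.while_true (ih (by simpa) (by simpa) (by simp [h3, h5])) (by norm_num)
      (by omega)).of ?_ (fun r _ => ?_) ?_
    · simp [Program.size]; omega
    · simp only [update_apply]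
      split_ifs <;> omega
    · simp [testWords, rename, encode, value, h4]

def printTests : Ram :=
  seq (literal 4) (seq (print (.test 0)) (seq (literal 4) (seq (print (.test 1)) (seq (literal 4)
    (seq (print (.test 3)) (seq (const 17 7) (seq testLoop (print (.test 17)))))))))

theorem does_printTests {m : ℕ → ℕ} {e : ℕ} (h3 : m 3 = 1) (h4 : m 4 = 2) (h5 : m 5 = e) :
    ∃ m', printTests.Does (9 * e + 30) m m'
      (tests 0 (1 :: 3 :: (List.range (e + 1)).map (fun k => 7 + 2 * k))).encode := by
  refine ⟨_, ((does_literal m 4).seq ((does_print m _).seq ((does_literal m 4).seq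
    ((does_print m _).seq ((does_literal m 4).seq ((does_print m _).seq
      ((does_const m 17 7).seq ((does_testLoop e (by simpa) (by simpa) (by simpa)).seq
        (does_print _ (.test 17)))))))))).of ?_ (fun _ _ => rfl) ?_⟩
  · simp [Program.size]; omega
  · have := encode_tests 7 e
    rw [List.range_succ_eq_map, List.map_cons, List.map_map]
    simp only [comp_def, mul_zero, add_zero]
    rw [show (fun j => 7 + 2 * (j + 1)) = fun j => 7 + 2 + 2 * j by funext j; ring]
    simp only [tests, encode, this]
    simp [rename, encode, value]

/-! ### The machine -/

def doubling : Ram := .while 16 (seq (add 14 14 14) (sub 16 16 3))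

theorem does_doubling {m : ℕ → ℕ} (k : ℕ) (h3 : m 3 = 1) (h16 : m 16 = k) :
    doubling.Does (k * 3 + 1) m (update (update m 16 0) 14 (2 ^ k * m 14)) [] := by
  induction k generalizing m with
  | zero =>
    refine (does_while_false (by norm_num) h16).of (by omega) (fun r _ => ?_) rfl
    simp only [update_apply]
    split_ifs <;> simp_all
  | succ k ih =>
    have h := ((does_add m 14 (show 14 ≠ 2 by norm_num) (show 14 ≠ 2 by norm_num)).seq
      (does_sub _ 16 (show 16 ≠ 2 by norm_num) (show 3 ≠ 2 by norm_num)))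
    refine (h.while_true (ih (by simpa) (by simp [h3, h16])) (by norm_num)
      (by omega)).of (by omega) (fun r _ => ?_) rfl
    by_cases hr : r = 14
    · subst hr
      simp
      ring
    · simp [hr, update_apply]

def multiply : Ram := .while 16 (seq (add 15 15 14) (sub 16 16 3))

theorem does_multiply {m : ℕ → ℕ} (k : ℕ) (h3 : m 3 = 1) (h16 : m 16 = k) :
    multiply.Does (k * 3 + 1) m (update (update m 16 0) 15 (m 15 + k * m 14)) [] := by
  induction k generalizing m with
  | zero =>
    refine (does_while_false (by norm_num) h16).of (by omega) (fun r _ => ?_) rfl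
    simp only [update_apply]
    split_ifs <;> simp_all
  | succ k ih =>
    have h := ((does_add m 15 (show 15 ≠ 2 by norm_num) (show 14 ≠ 2 by norm_num)).seq
      (does_sub _ 16 (show 16 ≠ 2 by norm_num) (show 3 ≠ 2 by norm_num)))
    refine (h.while_true (ih (by simpa) (by simp [h3, h16])) (by norm_num)
      (by omega)).of (by omega) (fun r _ => ?_) rfl
    by_cases hr : r = 15
    · subst hr
      simp
      ring
    · simp [hr, update_apply]

/-- Store the parameters of the initial part for `d = 1` in the registers `13`, `14`, `15`. -/
def baseParameters : Ram :=
  seq (const 14 2) (seq (add 16 1 18) (seq doubling (seq (add 15 14 18) (seq (add 16 1 18)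
    (seq multiply (seq (sub 13 15 3) (seq (add 14 13 13) (const 15 0))))))))

theorem does_baseParameters {m : ℕ → ℕ} (h3 : m 3 = 1) (h18 : m 18 = 0) :
    ∃ m', baseParameters.Does (6 * m 1 + 9) m m' [] ∧ (∀ r, r < 13 ∨ 16 < r → m' r = m r) ∧
      m' 13 = fastF 2 (m 1) ∧ m' 14 = 2 * fastF 2 (m 1) ∧ m' 15 = 0 := by
  refine ⟨_, ((does_const m 14 2).seq ((does_add _ 16 (show 1 ≠ 2 by norm_num)
    (show 18 ≠ 2 by norm_num)).seq ((does_doubling (m 1) (by simpa) (by simp [h18])).seq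
      ((does_add _ 15 (show 14 ≠ 2 by norm_num) (show 18 ≠ 2 by norm_num)).seq
        ((does_add _ 16 (show 1 ≠ 2 by norm_num) (show 18 ≠ 2 by norm_num)).seq
          ((does_multiply (m 1) (by simpa) (by simp [h18])).seq
            ((does_sub _ 13 (show 15 ≠ 2 by norm_num) (show 3 ≠ 2 by norm_num)).seq
              ((does_add _ 14 (show 13 ≠ 2 by norm_num) (show 13 ≠ 2 by norm_num)).seq
                (does_const _ 15 0))))))))).of (by omega) (fun _ _ => rfl) rfl, fun r hr => ?_,
    ?_, ?_, ?_⟩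
  -- One use for each register update in the chain; the two loops contribute two each.
  · iterate 11 refine (update_of_ne (by omega) _ _).trans ?_
    rfl
  all_goals
    have := fastF_two (m 1)
    simp [h3, h18]
  all_goals
    have e : 2 ^ m 1 * 2 + m 1 * (2 ^ m 1 * 2) = 2 ^ (m 1 + 1) * (m 1 + 1) := by ring
    omega

/-- Store the parameters of the initial part for `d > 1` in the registers `13`, `14`, `15`. -/
def parameters : Ram :=
  seq (const 14 1) (seq (add 16 1 1) (seq doubling (seq (add 15 14 14) (seq (add 16 1 18)
    (seq multiply (seq (sub 14 14 3) (add 13 1 18)))))))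

theorem does_parameters {m : ℕ → ℕ} (h3 : m 3 = 1) (h18 : m 18 = 0) :
    ∃ m', parameters.Does (9 * m 1 + 8) m m' [] ∧ (∀ r, r < 13 ∨ 16 < r → m' r = m r) ∧
      m' 13 = m 1 ∧ m' 14 = 4 ^ m 1 - 1 ∧ m' 15 = (m 1 + 2) * 4 ^ m 1 := by
  refine ⟨_, ((does_const m 14 1).seq ((does_add _ 16 (show 1 ≠ 2 by norm_num)
    (show 1 ≠ 2 by norm_num)).seq ((does_doubling (2 * m 1) (by simpa) (by simp; ring)).seq
      ((does_add _ 15 (show 14 ≠ 2 by norm_num) (show 14 ≠ 2 by norm_num)).seq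
        ((does_add _ 16 (show 1 ≠ 2 by norm_num) (show 18 ≠ 2 by norm_num)).seq
          ((does_multiply (m 1) (by simpa) (by simp [h18])).seq
            ((does_sub _ 14 (show 14 ≠ 2 by norm_num) (show 3 ≠ 2 by norm_num)).seq
              (does_add _ 13 (show 1 ≠ 2 by norm_num) (show 18 ≠ 2 by norm_num))))))))).of
    (by omega) (fun _ _ => rfl) rfl, fun r hr => ?_, ?_, ?_, ?_⟩
  · iterate 10 refine (update_of_ne (by omega) _ _).trans ?_
    rfl
  all_goals simp [h3, h18, pow_mul]
  ring

/-- Registers `3` and `4` hold the constants `1` and `2`, `5` holds `d - 1`, `6` the number of the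
top budget, and `12` the number `n + 1` of amplifiers. -/
def setup : Ram :=
  seq (const 3 1) (seq (const 4 2) (seq (sub 5 0 3) (seq (const 7 5) (seq (add 6 0 0)
    (seq (add 6 6 7) (add 12 1 3))))))

theorem does_setup {m : ℕ → ℕ} {e : ℕ} (h0 : m 0 = e + 1) (h18 : m 18 = 0) :
    ∃ m', setup.Does 7 m m' [] ∧ m' 1 = m 1 ∧ m' 3 = 1 ∧ m' 4 = 2 ∧ m' 5 = e ∧
      m' 6 = 7 + 2 * e ∧ m' 12 = m 1 + 1 ∧ m' 18 = 0 := by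
  refine ⟨_, ((does_const m 3 1).seq ((does_const _ 4 2).seq ((does_sub _ 5 (show 0 ≠ 2 by norm_num)
    (show 3 ≠ 2 by norm_num)).seq ((does_const _ 7 5).seq ((does_add _ 6 (show 0 ≠ 2 by norm_num)
      (show 0 ≠ 2 by norm_num)).seq ((does_add _ 6 (show 6 ≠ 2 by norm_num)
        (show 7 ≠ 2 by norm_num)).seq (does_add _ 12 (show 1 ≠ 2 by norm_num)
          (show 3 ≠ 2 by norm_num)))))))).of le_rfl (fun _ _ => rfl) rfl, ?_⟩
  simp [h0, h18]
  ring

/-- Print the final part of the preamplifiers. -/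
def printEnd : Ram :=
  ite 5 (seq (.while 12 printAmp) (print (.seq (step 1 1 0 1 2 3 8 1) (.seq (expo 2) settle))))
    (print (.seq (expo 1) settle))

/-- Print the preamplifier for the given `d` and `n`. -/
def printPreamp : Ram :=
  seq setup (seq (ite 5 parameters baseParameters) (seq resetLevel (seq (literal 4)
    (seq printStart (seq printEnd printTests)))))

theorem does_printPreamp_zero {m : ℕ → ℕ} (h0 : m 0 = 1) (h18 : m 18 = 0) :
    ∃ m', printPreamp.Does (6 * m 1 + 40 * fastF 2 (m 1) + 1000) m m' (preamp 0 (m 1)).encode := by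
  obtain ⟨m₁, h1, a1, a3, a4, a5, a6, a12, a18⟩ := does_setup (e := 0) h0 h18
  obtain ⟨m₂, h2, hm, b13, b14, b15⟩ := does_baseParameters a3 a18
  rw [a1] at h2 b13 b14
  have h3 := does_resetLevel (m := m₂) (e := 0) (by rw [hm 3 (by omega), a3])
    (by rw [hm 5 (by omega), a5]) (by rw [hm 6 (by omega), a6]) (by rw [hm 18 (by omega), a18])
  obtain ⟨w, h4, hw⟩ := does_printStart (m := levelMem m₂ 0)
    (by rw [levelMem_apply _ _ (by omega), hm 3 (by omega), a3])
    (by rw [levelMem_apply _ _ (by omega), hm 18 (by omega), a18])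
  have h5 := does_print_closed (update (update (levelMem m₂ 0) 13 0) 16 0)
    (M := .seq (expo 1) settle) (by rw [counters, counters_expo, counters_settle]; decide)
  obtain ⟨m', h6⟩ := does_printTests (m := update (update (levelMem m₂ 0) 13 0) 16 0) (e := 0)
    (by simp [levelMem, hm, a3]) (by simp [levelMem, hm, a4]) (by simp [levelMem, hm, a5])
  refine ⟨m', (h1.seq ((h2.ite_false (by norm_num) a5).seq (h3.seq ((does_literal _ 4).seq
    (h4.seq ((h5.ite_false (by norm_num) (by simp [levelMem, hm, a5])).seq h6)))))).of ?_
    (fun _ _ => rfl) ?_⟩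
  · have : (Program.seq (expo 1) settle).size ≤ 200 := by decide
    rw [levelMem_apply _ _ (by omega), levelMem_apply _ _ (by omega),
      levelMem_apply _ _ (by omega), b13, b14, b15]
    omega
  · have := hw (.seq (expo 1) settle)
    rw [levelMem_apply _ _ (by omega), levelMem_apply _ _ (by omega),
      levelMem_apply _ _ (by omega), b13, b14, b15] at this
    -- The machine has `7` where `mainPart` has `0` as budget counter; with zero increments of it,
    -- the two programs coincide definitionally.
    have e : (mainPart 0 (m 1)).encode = w ++ (Program.seq (expo 1) settle).encode := this
    have hp : (preamp 0 (m 1)).encode = 4 :: ((mainPart 0 (m 1)).encode ++ _) := rfl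
    rw [hp, e]
    simp

theorem does_printPreamp_succ {m : ℕ → ℕ} {e : ℕ} (h0 : m 0 = e + 2) (h18 : m 18 = 0) :
    ∃ m', printPreamp.Does (17 * m 1 + 16 * ((m 1 + 3) * 4 ^ m 1) + (m 1 + 1) * (e * 505 + 1401) +
      9 * e + 1500) m m' (preamp (e + 1) (m 1)).encode := by
  obtain ⟨m₁, h1, a1, a3, a4, a5, a6, a12, a18⟩ := does_setup (e := e + 1) h0 h18
  obtain ⟨m₂, h2, hm, b13, b14, b15⟩ := does_parameters a3 a18
  rw [a1] at h2 b13 b14 b15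
  have c3 : m₂ 3 = 1 := by rw [hm 3 (by omega), a3]
  have c4 : m₂ 4 = 2 := by rw [hm 4 (by omega), a4]
  have c5 : m₂ 5 = e + 1 := by rw [hm 5 (by omega), a5]
  have c6 : m₂ 6 = 9 + 2 * e := by rw [hm 6 (by omega), a6]; ring
  have c12 : m₂ 12 = m 1 + 1 := by rw [hm 12 (by omega), a12]
  have c18 : m₂ 18 = 0 := by rw [hm 18 (by omega), a18]
  have h3 := does_resetLevel (m := m₂) (e := e + 1) c3 c5 (by rw [c6]; ring) c18
  obtain ⟨w, h4, hw⟩ := does_printStart (m := levelMem m₂ (e + 1))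
    (by rw [levelMem_apply _ _ (by omega), c3]) (by rw [levelMem_apply _ _ (by omega), c18])
  -- The registers used up by the initial part are disjoint from those of the level, so the updates
  -- commute.
  have hcomm : update (update (levelMem m₂ (e + 1)) 13 0) 16 0 =
      levelMem (update (update m₂ 13 0) 16 0) (e + 1) := by
    funext r
    simp only [levelMem, update_apply]
    grind
  rw [hcomm] at h4
  have h5 := does_printAmps (m := update (update m₂ 13 0) 16 0) (e := e) (by simpa) (by simpa)
    (by simpa) (by simpa) (by simpa)
  generalize hm₃ : levelMem (update (update (update m₂ 13 0) 16 0) 12 0) (e + 1) = m₃ at h5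
  have h6 := does_print m₃ (.seq (step 1 1 0 1 2 3 8 1) (.seq (expo 2) settle))
  obtain ⟨m', h7⟩ := does_printTests (m := m₃) (e := e + 1)
    (by subst hm₃; simp [levelMem, c3]) (by subst hm₃; simp [levelMem, c4])
    (by subst hm₃; simp [levelMem, c5])
  refine ⟨m', (h1.seq ((h2.ite_true (by norm_num) (by omega)).seq (h3.seq ((does_literal _ 4).seq
    (h4.seq (((h5.seq h6).ite_true (by norm_num) (by simp [levelMem, c5])).seq h7)))))).of ?_
    (fun _ _ => rfl) ?_⟩
  · have : (Program.seq (step 1 1 0 1 2 3 8 1) (.seq (expo 2) settle)).size ≤ 300 := by decide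
    rw [levelMem_apply _ _ (by omega), levelMem_apply _ _ (by omega),
      levelMem_apply _ _ (by omega), b13, b14, b15, update_of_ne (by omega),
      update_of_ne (by omega), c12]
    have : (m 1 + 3) * 4 ^ m 1 = (m 1 + 2) * 4 ^ m 1 + 4 ^ m 1 := by ring
    generalize 4 ^ m 1 = p at *
    omega
  · have hend : ((Program.seq (step 1 1 0 1 2 3 8 1) (.seq (expo 2) settle)).rename
        (value m₃)) = .seq (step 1 1 0 1 2 3 (9 + 2 * e) 1) (.seq (expo 2) settle) := by
      rw [rename, rename_step, rename_eq_self (M := .seq (expo 2) settle)]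
      · subst hm₃
        simp [value, levelMem, show 7 + 2 * (e + 1) = 9 + 2 * e by ring]
      · intro c hc
        rw [counters, counters_expo, counters_settle] at hc
        exact if_pos (by simp at hc; omega)
    have := hw (amps (e + 1) (m 1 + 1)
      (.seq (step 1 1 0 1 2 3 (9 + 2 * e) 1) (.seq (expo 2) settle)))
    rw [levelMem_apply _ _ (by omega), levelMem_apply _ _ (by omega),
      levelMem_apply _ _ (by omega), b13, b14, b15, show levelMem m₂ (e + 1) 8 = 9 + 2 * e by
        simp [levelMem]; ring, encode_amps] at this
    have hmain : (mainPart (e + 1) (m 1)).encode = _ := this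
    have hp : (preamp (e + 1) (m 1)).encode = 4 :: ((mainPart (e + 1) (m 1)).encode ++ _) := rfl
    rw [hp, hmain, hend, update_of_ne (by omega), update_of_ne (by omega), c12]
    simp

/-! ### Time and size bounds -/

theorem Does.outputs {P : Ram} {T d n : ℕ} {m' : ℕ → ℕ} {w : List ℕ}
    (h : P.Does T (initial d n).mem m' w) : ∃ t ≤ T, P.Outputs d n t w := by
  obtain ⟨t, τ, ht, h1, _, h2⟩ := h (initial d n) fun _ _ => rfl
  exact ⟨t, ht, τ, h1, h2⟩

theorem Outputs.length_le {P : Ram} {d n t : ℕ} {w : List ℕ} (h : P.Outputs d n t w) :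
    w.length ≤ t := by
  obtain ⟨τ, h1, rfl⟩ := h
  simpa [initial] using h1.length_out_le

/-- Two contributions dominate: the initial increments, of order `n 4^n`, and for `d ≥ 2` the `n +
1` amplifiers, each of length linear in `d`. -/
theorem printPreamp_outputs (e n : ℕ) : ∃ t, printPreamp.Outputs (e + 1) n t (preamp e n).encode ∧
    (1 ≤ n → t ≤ 6000 * (n * (e + 1) * 4 ^ n)) := by
  have h1 : (initial (e + 1) n).mem 1 = n := rfl
  have h4 : 1 ≤ 4 ^ n := Nat.one_le_pow _ _ (by norm_num)
  cases e with
  | zero =>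
    obtain ⟨m', h⟩ := does_printPreamp_zero (m := (initial 1 n).mem) rfl rfl
    obtain ⟨t, ht, h⟩ := h.outputs
    rw [h1] at *
    refine ⟨t, h, fun hn => ht.trans ?_⟩
    have h2 : 2 ^ n ≤ 4 ^ n := Nat.pow_le_pow_left (by norm_num) n
    have h3 := fastF_two n
    have h5 : 2 ^ (n + 1) * (n + 1) ≤ 2 * 4 ^ n * (2 * n) :=
      Nat.mul_le_mul (by rw [pow_succ]; omega) (by omega)
    have h6 : n * 1 ≤ n * 4 ^ n := Nat.mul_le_mul le_rfl h4
    have h7 : 2 * 4 ^ n * (2 * n) = 4 * (n * 4 ^ n) := by ring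
    rw [zero_add, mul_one]
    omega
  | succ e =>
    obtain ⟨m', h⟩ := does_printPreamp_succ (m := (initial (e + 2) n).mem) rfl rfl
    obtain ⟨t, ht, h⟩ := h.outputs
    rw [h1] at *
    refine ⟨t, h, fun hn => ht.trans ?_⟩
    have h2 : n * 4 ^ n * 1 ≤ n * 4 ^ n * (e + 2) := Nat.mul_le_mul le_rfl (by omega)
    have h3 : n * 1 ≤ n * 4 ^ n := Nat.mul_le_mul le_rfl h4
    have h5 : 1 * 4 ^ n ≤ n * 4 ^ n := Nat.mul_le_mul hn le_rfl
    have h6 : n * (e + 2) * 1 ≤ n * (e + 2) * 4 ^ n := Nat.mul_le_mul le_rfl h4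
    have h7 : 1 * (e + 2) ≤ n * (e + 2) := Nat.mul_le_mul hn le_rfl
    have h8 : n * (e + 1 + 1) * 4 ^ n = n * 4 ^ n * (e + 2) := by ring
    have h9 : n * (e + 2) * 4 ^ n = n * 4 ^ n * (e + 2) := by ring
    nlinarith

end Ram

theorem mainTheorem4 :
    ∃ (P : Ram) (C x y b : ℕ), ∀ d n : ℕ, 1 ≤ d →
      ∃ (A : Program) (t : ℕ),
        P.Outputs d n t A.encode ∧
        A.IsPreamplifier (2 ^ fastF (d + 1) n) x y b ∧
        A.dimension = 2 * d + 6 ∧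
        (A.safe x y b).card = d ∧
        (1 ≤ n → t ≤ C * (n * d * 4 ^ n) ∧ A.size ≤ C * (n * d * 4 ^ n)) := by
  refine ⟨Ram.printPreamp, 6000, 2, 5, 6, fun d n hd => ?_⟩
  obtain ⟨e, rfl⟩ : ∃ e, d = e + 1 := ⟨d - 1, by omega⟩
  obtain ⟨t, h, ht⟩ := Ram.printPreamp_outputs e n
  exact ⟨Program.preamp e n, t, h, Program.preamp_isPreamplifier e n,
    Program.dimension_preamp e n, Program.safe_preamp e n, fun hn => ⟨ht hn,
      ((Program.size_le_length_encode _).trans h.length_le).trans (ht hn)⟩⟩
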